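/- Notation. Let $\operatorname{Im}\tau>0$, $q=e^{2\pi i\tau}$, $w=e^{2\pi i x}$, $(a;q)=\prod_{j\ge 0}(1-aq^j)$, and $$\theta(x)=\theta(x,\tau)=\tfrac{\sin \pi x}{\pi}\,(qw;q)(q/w;q)(q;q)^{-2},\qquad \rho(x)=\frac{\theta'(x)}{\theta(x)},\qquad \sigma(x,y)=\frac{\theta(x+y)}{\theta(x)\theta(y)} .$$ Let $m_1,\dots,m_n\in\mathbb Z_{\ge 0}$ with $\sum_s m_s=2m$, and let $z_1,\dots,z_n\in\mathbb C$ be pairwise distinct modulo $\mathbb Z+\tau\mathbb Z$. Let $V_{d}$ be the irreducible $\mathfrak{sl}_2$-module of highest weight $d$, regarded as a $\mathfrak{gl}_2$-module on which $e_{11}+e_{22}$ acts by $0$; put $V=V_{m_1}\otimes\dots\otimes V_{m_n}$, let $V[0]$ be its zero weight subspace, and let $e_{jl}^{(k)}$ be $e_{jl}$ acting in the $k$-th factor. Let $\lambda_{jl}=\lambda_j-\lambda_l$, let $$e^+_{jj}(x)=\sum_{k}\rho(x-z_k)e_{jj}^{(k)},\qquad e^+_{jl}(x)=\sum_k\sigma(x-z_k,\lambda_{jl})e_{jl}^{(k)}\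 (j\neq l),$$ and let $\mathcal L_{jj}=e^+_{jj}(x)+\sum_{l\ne j}\rho(\lambda_{jl})\sum_k e_{ll}^{(k)}$, $\mathcal L_{jl}=e^+_{lj}(x)$ for $j\ne l$, where $j,l\in\{1,2\}$. The universal differential operator is the column determinant $$\mathcal D=(\partial_x-\partial_{\lambda_1}+\mathcal L_{11})(\partial_x-\partial_{\lambda_2}+\mathcal L_{22})-\mathcal L_{21}\mathcal L_{12}=\partial_x^2+S_1(x)\partial_x+S_2(x),$$ acting on $V[0]$-valued meromorphic functions of $\lambda_1,\lambda_2$ that depend only on $\lambda_{12}$. A solution of the Bethe ansatz equations is $(\mu,t,z,\tau)$ with $\mu\in\mathbb C$, $t=(t_1,\dots,t_m)\in\mathbb C^m$, where the $t_i$ are pairwise distinct and distinct from all $z_s$ modulo $\mathbb Z+\tau\mathbb Z$, and $$2\pi i\mu+2\sum_{j\ne i}\rho(t_i-t_j)-\sum_{s=1}^n m_s\,\rho(t_i-z_s)=0,\qquad i=1,\dots,m.$$ Its Bethe eigenfunction is $$\Psi(\lambda_{12})=e^{\pi i\mu\lambda_{12}}\sum_{k_1+\dots+k_n=m}W_{k}(\lambda_{12})\;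 e_{21}^{k_1}v_{m_1}\otimes\dots\otimes e_{21}^{k_n}v_{m_n},\qquad W_k(\lambda_{12})=\sum_{c}\prod_{i=1}^m\sigma(t_i-z_{c(i)},-\lambda_{12}),$$ where $v_{d}$ is a highest weight vector of $V_{d}$ and $c$ runs over the maps $\{1,\dots,m\}\to\{1,\dots,n\}$ that take each value $s$ exactly $k_s$ times. Theorem. Let $(\mu,t,z,\tau)$ be a solution of the Bethe ansatz equations. Then $\Psi$ is a nonzero meromorphic $V[0]$-valued function of $\lambda_{12}$, and there is a scalar function $B_2$, unique and holomorphic on the complement of $\bigcup_s(z_s+\mathbb Z+\tau\mathbb Z)$, such that $S_2(x)\Psi=B_2(x)\Psi$. With $$u(x)=e^{\pi i\mu x}\prod_{i=1}^m\theta(x-t_i)\prod_{s=1}^n\theta(x-z_s)^{-m_s/2}$$ (any local holomorphic branch, away from the points of $t_i+\mathbb Z+\tau\mathbb Z$ and $z_s+\mathbb Z+\tau\mathbb Z$; $(\ln u)'=u'/u$) one has $$B_2(x)=-(\ln u)''-\big((\ln u)'\big)^2 .$$ In other words, the fundamental differential operator $\partial_x^2+B_2(x)$ of $\Psi$ factors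 as $$\partial_x^2+B_2(x)=\big(\partial_x+(\ln u)'\big)\big(\partial_x-(\ln u)'\big).$$ -/

import Mathlib

open scoped BigOperators

noncomputable section

namespace EllipticBethe

/-! ### Theta functions -/

/-- The infinite product `(w; q) = ∏_{j ≥ 0} (1 - w q^j)` (used for `|q| < 1`). -/
def qProd (w q : ℂ) : ℂ := ∏' j : ℕ, (1 - w * q ^ j)

/-- The normalized first Jacobi theta function, with `w = e^{2πix}`, `q = e^{2πiτ}`:
`θ(x,τ) = (sin(πx)/π) (qw;q) (q/w;q) (q;q)^{-2}`. -/
def theta (x τ : ℂ) : ℂ :=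
  let q := Complex.exp (2 * Real.pi * Complex.I * τ)
  let w := Complex.exp (2 * Real.pi * Complex.I * x)
  Complex.sin (Real.pi * x) / Real.pi * qProd (q * w) q * qProd (q / w) q * ((qProd q q) ^ 2)⁻¹

/-- `ρ = θ'/θ`, the derivative being taken in the first variable. -/
def rho (x τ : ℂ) : ℂ := logDeriv (fun y => theta y τ) x

/-- `σ(x,w) = θ(x+w) / (θ(x) θ(w))`. -/
def sigma (x w τ : ℂ) : ℂ := theta (x + w) τ / (theta x τ * theta w τ)

/-- The lattice `ℤ + τℤ`. -/
def lattice (τ : ℂ) : Set ℂ := {x | ∃ a b : ℤ, x = a + b * τ}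

/-! ### The irreducible modules and their tensor product -/

/-- `e_{12}` on the irreducible `sl₂`-module of highest weight `d` in the basis
`v_k = e_{21}^k v_0`, `k = 0, …, d`: `e_{12} v_k = k (d - k + 1) v_{k-1}`. -/
def raiseMat (d : ℕ) : Matrix (Fin (d + 1)) (Fin (d + 1)) ℂ :=
  Matrix.of fun a b =>
    if (b : ℕ) = a + 1 then ((b : ℕ) : ℂ) * ((d : ℂ) - ((b : ℕ) : ℂ) + 1) else 0

/-- `e_{21} v_k = v_{k+1}` for `k < d`, and `e_{21} v_d = 0`. -/
def lowerMat (d : ℕ) : Matrix (Fin (d + 1)) (Fin (d + 1)) ℂ :=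
  Matrix.of fun a b => if (a : ℕ) = b + 1 then 1 else 0

/-- `(e_{11} - e_{22}) v_k = (d - 2k) v_k`. -/
def weightMat (d : ℕ) : Matrix (Fin (d + 1)) (Fin (d + 1)) ℂ :=
  Matrix.diagonal fun a => (d : ℂ) - 2 * ((a : ℕ) : ℂ)

/-- The matrix of `e_{jl} ∈ gl₂` on the irreducible `sl₂`-module of highest weight `d`, on which
`e_{11} + e_{22}` acts by zero. The indices `1, 2` are written `0, 1 : Fin 2`. -/
def glMat (d : ℕ) (j l : Fin 2) : Matrix (Fin (d + 1)) (Fin (d + 1)) ℂ :=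
  (!![(1 / 2 : ℂ) • weightMat d, raiseMat d; lowerMat d, -((1 / 2 : ℂ) • weightMat d)] :
    Matrix (Fin 2) (Fin 2) (Matrix (Fin (d + 1)) (Fin (d + 1)) ℂ)) j l

/-- `V = V_{m_1} ⊗ ⋯ ⊗ V_{m_n}` in the product basis `v_{k_1} ⊗ ⋯ ⊗ v_{k_n}`, `0 ≤ k_s ≤ m_s`:
a vector is the family of its coordinates. -/
abbrev TensorSpace {n : ℕ} (m : Fin n → ℕ) : Type := ((s : Fin n) → Fin (m s + 1)) → ℂ

/-- The operator `1 ⊗ ⋯ ⊗ A ⊗ ⋯ ⊗ 1` with `A` in the `s`-th factor. -/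
def siteOp {n : ℕ} (m : Fin n → ℕ) (s : Fin n)
    (A : Matrix (Fin (m s + 1)) (Fin (m s + 1)) ℂ) : Module.End ℂ (TensorSpace m) where
  toFun v := fun k => ∑ b, A (k s) b * v (Function.update k s b)
  map_add' v w := by
    funext k
    simp [mul_add, Finset.sum_add_distrib]
  map_smul' c v := by
    funext k
    simp [Finset.mul_sum, mul_left_comm]

/-- `e_{jl}^{(s)}`. -/
def eSite {n : ℕ} (m : Fin n → ℕ) (j l : Fin 2) (s : Fin n) : Module.End ℂ (TensorSpace m) :=
  siteOp m s (glMat (m s) j l)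

/-- `e_{jl}` acting on the tensor product, `e_{jl}^{(1)} + ⋯ + e_{jl}^{(n)}`. -/
def eTotal {n : ℕ} (m : Fin n → ℕ) (j l : Fin 2) : Module.End ℂ (TensorSpace m) :=
  ∑ s, eSite m j l s

/-- The zero weight subspace `V[0]`. -/
def zeroWeight {n : ℕ} (m : Fin n → ℕ) : Submodule ℂ (TensorSpace m) :=
  ⨅ j : Fin 2, LinearMap.ker (eTotal m j j)

/-- `ψ` belongs to `Fun_{sl₂}(V[0])`: it is a meromorphic `V[0]`-valued function of
`λ₁, λ₂` which depends only on the difference `λ₁ - λ₂`. -/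
def IsFun {n : ℕ} (m : Fin n → ℕ) (ψ : (Fin 2 → ℂ) → TensorSpace m) : Prop :=
  ∃ g : ℂ → TensorSpace m,
    Meromorphic g ∧ (∀ w, g w ∈ zeroWeight m) ∧ ∀ lam, ψ lam = g (lam 0 - lam 1)

/-! ### The universal (RST) differential operator for `N = 2` -/

/-- `e^+_{jl}(x)`: `∑_k ρ(x - z_k) e_{jj}^{(k)}` for `j = l`, and
`∑_k σ(x - z_k, λ_j - λ_l) e_{jl}^{(k)}` for `j ≠ l`. -/
def ePlus {n : ℕ} (m : Fin n → ℕ) (z : Fin n → ℂ) (τ : ℂ) (j l : Fin 2) (x : ℂ)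
    (lam : Fin 2 → ℂ) : Module.End ℂ (TensorSpace m) :=
  if j = l then ∑ k, rho (x - z k) τ • eSite m j j k
  else ∑ k, sigma (x - z k) (lam j - lam l) τ • eSite m j l k

/-- The matrix `𝓛`: `𝓛_{jj} = e^+_{jj}(x) + ∑_{l ≠ j} ρ(λ_j - λ_l) e_{ll}` and
`𝓛_{jl} = e^+_{lj}(x)` for `j ≠ l`. -/
def lax {n : ℕ} (m : Fin n → ℕ) (z : Fin n → ℂ) (τ : ℂ) (j l : Fin 2) (x : ℂ)
    (lam : Fin 2 → ℂ) : Module.End ℂ (TensorSpace m) :=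
  if j = l then
    ePlus m z τ j j x lam + ∑ p ∈ Finset.univ.erase j, rho (lam j - lam p) τ • eTotal m p p
  else ePlus m z τ l j x lam

/-- The entry `δ_{jl} ∂_x - δ_{jl} ∂_{λ_j} + 𝓛_{jl}` as an operator on `V`-valued functions of
`x` and `λ = (λ₁, λ₂)`. -/
def rstEntry {n : ℕ} (m : Fin n → ℕ) (z : Fin n → ℂ) (τ : ℂ) (j l : Fin 2)
    (F : ℂ → (Fin 2 → ℂ) → TensorSpace m) : ℂ → (Fin 2 → ℂ) → TensorSpace m :=
  fun x lam =>
    (if j = l then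
      deriv (fun y => F y lam) x - deriv (fun w => F x (Function.update lam j w)) (lam j)
    else 0) + lax m z τ j l x lam (F x lam)

/-- The universal differential operator `𝓓`, the column determinant
`∑_π (-1)^π X_{π(1),1} X_{π(2),2}` of the matrix of the operators `rstEntry`. -/
def rstOp {n : ℕ} (m : Fin n → ℕ) (z : Fin n → ℂ) (τ : ℂ)
    (F : ℂ → (Fin 2 → ℂ) → TensorSpace m) : ℂ → (Fin 2 → ℂ) → TensorSpace m :=
  fun x lam => ∑ π : Equiv.Perm (Fin 2), ((Equiv.Perm.sign π : ℤ) : ℂ) •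
    rstEntry m z τ (π 0) 0 (rstEntry m z τ (π 1) 1 F) x lam

/-- The coefficient `S_2(x)` in `𝓓 = ∂_x² + S_1(x) ∂_x + S_2(x)`. It is the term without `∂_x`,
that is, `S_2(x) ψ` is the value at `x` of `𝓓` on `ψ` regarded as a function constant in `x`. -/
def S2 {n : ℕ} (m : Fin n → ℕ) (z : Fin n → ℂ) (τ x : ℂ)
    (ψ : (Fin 2 → ℂ) → TensorSpace m) : (Fin 2 → ℂ) → TensorSpace m :=
  rstOp m z τ (fun _ => ψ) x

/-- `S_2(x) ψ = B(x) ψ`, for a function `ψ` with poles only at `λ₁ - λ₂ ∈ ℤ + τℤ`; the equation is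
imposed at all points where the coefficients of `S_2(x)` and `ψ` are holomorphic. -/
def IsS2Eigenvalue {n : ℕ} (m : Fin n → ℕ) (z : Fin n → ℂ) (τ : ℂ)
    (ψ : (Fin 2 → ℂ) → TensorSpace m) (B : ℂ → ℂ) : Prop :=
  ∀ x : ℂ, (∀ s, x - z s ∉ lattice τ) →
    ∀ lam : Fin 2 → ℂ, lam 0 - lam 1 ∉ lattice τ → S2 m z τ x ψ lam = B x • ψ lam

/-! ### Bethe ansatz -/

/-- `(μ, t, z, τ)` is a solution of the Bethe ansatz equations
`2πiμ + 2 ∑_{j ≠ i} ρ(t_i - t_j) - ∑_s m_s ρ(t_i - z_s) = 0`; all the terms are required to be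
defined. -/
structure IsBetheSolution {n M : ℕ} (m : Fin n → ℕ) (μ : ℂ) (t : Fin M → ℂ) (z : Fin n → ℂ)
    (τ : ℂ) : Prop where
  t_sub_t : ∀ i j, i ≠ j → t i - t j ∉ lattice τ
  t_sub_z : ∀ i s, t i - z s ∉ lattice τ
  equation : ∀ i, 2 * Real.pi * Complex.I * μ
      + 2 * ∑ j ∈ Finset.univ.erase i, rho (t i - t j) τ
      - ∑ s, (m s : ℂ) * rho (t i - z s) τ = 0

/-- The Bethe eigenfunction
`Ψ(λ) = e^{πiμλ₁₂} ∑_{k_1 + ⋯ + k_n = M} W_k(λ₁₂) e_{21}^{k_1} v ⊗ ⋯ ⊗ e_{21}^{k_n} v`, `λ₁₂ = λ₁ - λ₂`,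
`v` the highest weight vectors, where `W_k` is the sum of `∏_i σ(t_i - z_{c(i)}, -λ₁₂)` over all
maps `c` from the indices of the `t_i` to the tensor factors that take each value `s` exactly
`k_s` times. (If all `m_s = 1`, `W_k` is the symmetrization in `t` of
`∏_i σ(t_i - z_{s_i}, -λ₁₂)`, where `s_1 < ⋯ < s_M` are the factors with `k_s = 1`.) -/
def betheFunction {n M : ℕ} (m : Fin n → ℕ) (μ : ℂ) (t : Fin M → ℂ) (z : Fin n → ℂ) (τ : ℂ) :
    (Fin 2 → ℂ) → TensorSpace m :=
  fun lam k => Complex.exp (Real.pi * Complex.I * μ * (lam 0 - lam 1)) *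
    ∑ c ∈ (Finset.univ : Finset (Fin M → Fin n)).filter
        (fun c => ∀ s, (Finset.univ.filter (fun i => c i = s)).card = (k s : ℕ)),
      ∏ i, sigma (t i - z (c i)) (-(lam 0 - lam 1)) τ

/-! ### The fundamental differential operator and the function `u` -/

/-- `u` is, on the open set `U`, a holomorphic branch of
`e^{πiμx} ∏_i θ(x - t_i) ∏_s θ(x - z_s)^{-m_s/2}`; `U` avoids the zeros and singularities of the
latter, and `r s` is a holomorphic branch of `θ(x - z_s)^{-m_s/2}`. -/
def IsBranchU {n M : ℕ} (m : Fin n → ℕ) (μ : ℂ) (t : Fin M → ℂ) (z : Fin n → ℂ) (τ : ℂ)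
    (U : Set ℂ) (u : ℂ → ℂ) : Prop :=
  IsOpen U ∧ (∀ x ∈ U, (∀ i, x - t i ∉ lattice τ) ∧ ∀ s, x - z s ∉ lattice τ) ∧
  ∃ r : Fin n → ℂ → ℂ,
    (∀ s, DifferentiableOn ℂ (r s) U ∧ ∀ x ∈ U, r s x ^ 2 = (theta (x - z s) τ ^ m s)⁻¹) ∧
    ∀ x ∈ U, u x = Complex.exp (Real.pi * Complex.I * μ * x) *
      (∏ i, theta (x - t i) τ) * ∏ s, r s x

/-- The scalar differential operator `∂_x² + B(x)`. -/
def fundOp (B : ℂ → ℂ) (f : ℂ → ℂ) : ℂ → ℂ := fun x => deriv (deriv f) x + B x * f x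

/-- The first order differential operator `∂_x + a(x)`. -/
def firstOrderOp (a : ℂ → ℂ) (f : ℂ → ℂ) : ℂ → ℂ := fun x => deriv f x + a x * f x

end EllipticBethe

end

noncomputable section

namespace EllipticBethe

open Filter Topology Set

/-! ### The theta function -/

/-! Put w = λ₁₂. Each V_{m_s} is a quotient of a Verma module, so V is a quotient of the polynomials
in X_1, …, X_n: e_21^{(s)} is multiplication by X_s, and e_12^{(s)} is m_s ∂_s − X_s ∂_s². In this
model Ψ is e^{πiμw} ∏ ℓ_i with linear forms ℓ_i = ∑_s σ(t_i − z_s, −w) X_s; the sum over the maps c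
is the expanded product. The entry 𝓛_12 = e^+_21(x) is multiplication by the form ℓ_x with x in
place of t_i.

On zero weight functions S_2(x) becomes −(∂_w − h)² − h' − e^+_12(x) e^+_21(x), where h = ∑ ρ(x −
z_s) e_11^{(s)} and the prime is the derivative in x (`S2_apply`). On X^k one has h = a − ∑ k_s ρ(x
− z_s) with a = ½ ∑ m_s ρ(x − z_s), so ∂_w − h = D − a for the derivation D = ∂_w + ∑ ρ(x − z_s) X_s
∂_s. A three-term identity gives D ℓ_i = ρ(x − t_i) ℓ_i − σ(x − t_i, w) ℓ_x, so D²Ψ is a multiple of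
Ψ plus unwanted terms. Moving e^+_12(x) past ℓ_x produces a Cartan term that changes −h' into +h'.
What remains is e^+_12(x) on the product of the ℓ_i, where the Bethe equations enter
(`sum_sigma_mul_raisePoly`). The unwanted terms then cancel (`betheForm_eigen`) and leave −U' − U²
times Ψ, with U = πiμ + ∑ ρ(x − t_i) − a = (ln u)'.

All identities for ρ and σ come from one addition theorem, `theta_addition`: ρ(a) + ρ(b) + ρ(c) −
ρ(a+b+c) is a quotient of products of θ, which Liouville's theorem proves.

The computation needs x away from the t_i. Since S_2(x)Ψ is analytic in x away from the z_s alone,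
density of the good x gives the rest. Dividing by a nonzero coordinate of Ψ produces B_2; such a
coordinate exists by the leading pole of Ψ at w = 0 (`exists_betheVector_ne_zero`). -/

lemma summable_norm_neg_mul_pow (w : ℂ) {q : ℂ} (hq : ‖q‖ < 1) :
    Summable fun j : ℕ => ‖-(w * q ^ j)‖ := by
  simp only [norm_neg, norm_mul, norm_pow]
  exact (summable_geometric_of_lt_one (norm_nonneg q) hq).mul_left _

lemma differentiable_qProd {q : ℂ} (hq : ‖q‖ < 1) : Differentiable ℂ fun w => qProd w q := by
  intro w
  have hopen : IsOpen (Metric.ball (0 : ℂ) (‖w‖ + 1)) := Metric.isOpen_ball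
  have h : HasProdLocallyUniformlyOn (fun (j : ℕ) x => 1 + -(x * q ^ j))
      (fun x => ∏' j : ℕ, (1 + -(x * q ^ j))) (Metric.ball (0 : ℂ) (‖w‖ + 1)) := by
    refine Summable.hasProdLocallyUniformlyOn_nat_one_add hopen
      (u := fun j => (‖w‖ + 1) * ‖q‖ ^ j)
      ((summable_geometric_of_lt_one (norm_nonneg q) hq).mul_left _) ?_ ?_
    · refine Eventually.of_forall fun j x hx => ?_
      simp only [norm_neg, norm_mul, norm_pow]
      have : ‖x‖ < ‖w‖ + 1 := by simpa using hx
      gcongr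
    · intro j
      fun_prop
  have h2 : DifferentiableOn ℂ (fun x => ∏' j : ℕ, (1 + -(x * q ^ j)))
      (Metric.ball (0 : ℂ) (‖w‖ + 1)) := by
    refine TendstoLocallyUniformlyOn.differentiableOn
      (hasProdLocallyUniformlyOn_iff_tendstoLocallyUniformlyOn.mp h)
      (Eventually.of_forall fun s => ?_) hopen
    fun_prop
  have h3 := h2.differentiableAt (hopen.mem_nhds (x := w) (by simp))
  simpa only [qProd, sub_eq_add_neg] using h3

lemma qProd_ne_zero {w q : ℂ} (hq : ‖q‖ < 1) (h : ∀ j : ℕ, w * q ^ j ≠ 1) : qProd w q ≠ 0 := by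
  have := tprod_one_add_ne_zero_of_summable (f := fun j : ℕ => -(w * q ^ j))
    (fun j h0 => h j (by linear_combination -h0)) (summable_norm_neg_mul_pow w hq)
  simpa only [qProd, sub_eq_add_neg] using this

lemma qProd_eq_mul (w : ℂ) {q : ℂ} (hq : ‖q‖ < 1) :
    qProd w q = (1 - w) * qProd (q * w) q := by
  have hm : Multipliable fun j : ℕ => (1 + -((q * w) * q ^ j)) :=
    multipliable_one_add_of_summable (summable_norm_neg_mul_pow (q * w) hq)
  unfold qProd
  rw [tprod_eq_zero_mul']
  · simp only [pow_zero, mul_one]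
    congr 1
    exact tprod_congr fun j => by ring
  · refine hm.congr fun j => ?_
    ring

lemma norm_exp_two_pi_I_mul_lt_one {τ : ℂ} (hτ : 0 < τ.im) :
    ‖Complex.exp (2 * Real.pi * Complex.I * τ)‖ < 1 := by
  rw [Complex.norm_exp]
  rw [Real.exp_lt_one_iff]
  simp
  positivity

lemma differentiable_theta {τ : ℂ} (hτ : 0 < τ.im) : Differentiable ℂ fun x => theta x τ := by
  have hq := norm_exp_two_pi_I_mul_lt_one hτ
  have hP := differentiable_qProd hq
  unfold theta
  refine Differentiable.mul (Differentiable.mul (Differentiable.mul (by fun_prop) ?_) ?_)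
    (by fun_prop)
  · exact hP.comp (g := fun w => qProd w _)
      (f := fun x : ℂ => Complex.exp (2 * Real.pi * Complex.I * τ) *
        Complex.exp (2 * Real.pi * Complex.I * x)) (by fun_prop)
  · exact hP.comp (g := fun w => qProd w _)
      (f := fun x : ℂ => Complex.exp (2 * Real.pi * Complex.I * τ) /
        Complex.exp (2 * Real.pi * Complex.I * x))
      (Differentiable.div (by fun_prop) (by fun_prop) fun x => Complex.exp_ne_zero _)

lemma theta_neg (x τ : ℂ) : theta (-x) τ = -theta x τ := by
  simp only [theta, mul_neg, Complex.exp_neg, Complex.sin_neg, div_inv_eq_mul]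
  rw [← div_eq_mul_inv]
  ring_nf

lemma theta_zero (τ : ℂ) : theta 0 τ = 0 := by simp [theta]

lemma theta_add_one (x τ : ℂ) : theta (x + 1) τ = -theta x τ := by
  have h : Complex.exp (2 * Real.pi * Complex.I * (x + 1)) =
      Complex.exp (2 * Real.pi * Complex.I * x) := by
    rw [mul_add, mul_one, Complex.exp_add, Complex.exp_two_pi_mul_I, mul_one]
  simp only [theta, h]
  rw [mul_add, mul_one, Complex.sin_add_pi]
  ring

lemma theta_add_tau (x : ℂ) {τ : ℂ} (hτ : 0 < τ.im) :
    theta (x + τ) τ =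
      -Complex.exp (-(Real.pi * Complex.I * τ)) * Complex.exp (-(2 * Real.pi * Complex.I) * x) *
        theta x τ := by
  have hq := norm_exp_two_pi_I_mul_lt_one hτ
  simp only [theta]
  set q := Complex.exp (2 * Real.pi * Complex.I * τ) with hqd
  -- In the half-angle exponentials A and B the sines are Laurent polynomials. The shift by τ
  -- removes the factor 1 − qw from one product and adds 1 − 1/w to the other, and these two factors
  -- account for the change of the sine.
  set A := Complex.exp (Real.pi * Complex.I * x) with hA
  set B := Complex.exp (Real.pi * Complex.I * τ) with hB
  have hA0 : A ≠ 0 := Complex.exp_ne_zero _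
  have hB0 : B ≠ 0 := Complex.exp_ne_zero _
  have hw : Complex.exp (2 * Real.pi * Complex.I * x) = A ^ 2 := by
    rw [hA, ← Complex.exp_nat_mul]; congr 1; push_cast; ring
  have hqB : q = B ^ 2 := by
    rw [hqd, hB, ← Complex.exp_nat_mul]; congr 1; push_cast; ring
  have hwx : Complex.exp (2 * Real.pi * Complex.I * (x + τ)) = q * A ^ 2 := by
    rw [mul_add, Complex.exp_add, hw, mul_comm]
  have hmw : Complex.exp (-(2 * Real.pi * Complex.I) * x) = (A ^ 2)⁻¹ := by
    rw [neg_mul, Complex.exp_neg, hw]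
  have hmB : Complex.exp (-(Real.pi * Complex.I * τ)) = B⁻¹ := by
    rw [Complex.exp_neg]
  have hs : Complex.sin (Real.pi * x) = (A⁻¹ - A) * Complex.I / 2 := by
    rw [Complex.sin, hA, ← Complex.exp_neg]
    congr 4 <;> ring_nf
  have hs2 : Complex.sin (Real.pi * (x + τ)) = ((A * B)⁻¹ - A * B) * Complex.I / 2 := by
    rw [Complex.sin, hA, hB, ← Complex.exp_add, ← Complex.exp_neg]
    congr 4 <;> ring_nf
  have hq0 : q ≠ 0 := Complex.exp_ne_zero _
  rw [hwx, hw, hmw, hmB, hs, hs2, qProd_eq_mul (q * A ^ 2) hq,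
    show q / (q * A ^ 2) = (A ^ 2)⁻¹ by field_simp, qProd_eq_mul ((A ^ 2)⁻¹) hq,
    ← div_eq_mul_inv q]
  have hpi : (Real.pi : ℂ) ≠ 0 := by exact_mod_cast Real.pi_ne_zero
  rw [show (1 - q * A ^ 2) = (1 - B ^ 2 * A ^ 2) by rw [hqB]]
  generalize qProd (q * (q * A ^ 2)) q = X
  generalize qProd (q / A ^ 2) q = Y
  generalize ((qProd q q) ^ 2)⁻¹ = Z
  field_simp
  ring

/-- Only the sine vanishes at 0; the factor (q;q)^{-2} normalizes the remaining product `G` to 1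
there. -/
lemma hasDerivAt_theta_zero {τ : ℂ} (hτ : 0 < τ.im) :
    HasDerivAt (fun x => theta x τ) 1 0 := by
  have hq := norm_exp_two_pi_I_mul_lt_one hτ
  have hP := differentiable_qProd hq
  set q := Complex.exp (2 * Real.pi * Complex.I * τ) with hqd
  have hpi : (Real.pi : ℂ) ≠ 0 := by exact_mod_cast Real.pi_ne_zero
  have hQ : qProd q q ≠ 0 := by
    refine qProd_ne_zero hq fun j hj => ?_
    have h1 : ‖q * q ^ j‖ < 1 := by
      rw [← pow_succ', norm_pow]
      exact pow_lt_one₀ (norm_nonneg _) hq (by simp)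
    rw [hj] at h1
    simp at h1
  let G : ℂ → ℂ := fun x => qProd (q * Complex.exp (2 * Real.pi * Complex.I * x)) q *
    qProd (q / Complex.exp (2 * Real.pi * Complex.I * x)) q * ((qProd q q) ^ 2)⁻¹
  have hG : Differentiable ℂ G := by
    refine Differentiable.mul (Differentiable.mul ?_ ?_) (by fun_prop)
    · exact hP.comp (g := fun w => qProd w _)
        (f := fun x : ℂ => q * Complex.exp (2 * Real.pi * Complex.I * x)) (by fun_prop)
    · exact hP.comp (g := fun w => qProd w _)
        (f := fun x : ℂ => q / Complex.exp (2 * Real.pi * Complex.I * x))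
        (Differentiable.div (by fun_prop) (by fun_prop) fun x => Complex.exp_ne_zero _)
  have hG0 : G 0 = 1 := by
    simp only [G, mul_zero, Complex.exp_zero, mul_one, div_one]
    field_simp
  have hs : HasDerivAt (fun x : ℂ => Complex.sin (Real.pi * x) / Real.pi) 1 0 := by
    have := (((hasDerivAt_id (0 : ℂ)).const_mul (Real.pi : ℂ)).csin).div_const (Real.pi : ℂ)
    simpa [hpi] using this
  have := hs.mul (hG 0).hasDerivAt
  rw [hG0] at this
  simp only [mul_zero, Complex.sin_zero, zero_div, zero_mul, add_zero, mul_one] at this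
  refine this.congr_of_eventuallyEq (Eventually.of_forall fun x => ?_)
  simp only [theta, G, ← hqd, Pi.mul_apply]
  ring

/-- The lattice as an additive subgroup. -/
def latticeSubgroup (τ : ℂ) : AddSubgroup ℂ where
  carrier := lattice τ
  zero_mem' := ⟨0, 0, by simp⟩
  add_mem' := by
    rintro _ _ ⟨a, b, rfl⟩ ⟨c, d, rfl⟩
    exact ⟨a + c, b + d, by push_cast; ring⟩
  neg_mem' := by
    rintro _ ⟨a, b, rfl⟩
    exact ⟨-a, -b, by push_cast; ring⟩

lemma neg_mem_lattice_iff {x τ : ℂ} : -x ∈ lattice τ ↔ x ∈ lattice τ :=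
  neg_mem_iff (H := latticeSubgroup τ)

lemma countable_lattice (τ : ℂ) : (lattice τ).Countable := by
  have : lattice τ = Set.range fun p : ℤ × ℤ => (p.1 : ℂ) + p.2 * τ := by
    ext x
    simp [lattice, eq_comm]
  rw [this]
  exact Set.countable_range _

/-- The subgroup of the quasi-periods of `θ`. -/
def quasiPeriods (τ : ℂ) : AddSubgroup ℂ where
  carrier := {l | ∃ K c : ℂ, K ≠ 0 ∧ ∀ x, theta (x + l) τ = K * Complex.exp (c * x) * theta x τ}
  zero_mem' := ⟨1, 0, one_ne_zero, fun x => by simp⟩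
  add_mem' := by
    rintro a b ⟨K, c, hK, h⟩ ⟨K', c', hK', h'⟩
    refine ⟨K * K' * Complex.exp (c' * a), c + c', mul_ne_zero (mul_ne_zero hK hK')
      (Complex.exp_ne_zero _), fun x => ?_⟩
    rw [← add_assoc, h', h, mul_add, add_mul, Complex.exp_add, Complex.exp_add]
    ring
  neg_mem' := by
    rintro a ⟨K, c, hK, h⟩
    refine ⟨K⁻¹ * Complex.exp (c * a), -c, mul_ne_zero (inv_ne_zero hK) (Complex.exp_ne_zero _),
      fun x => ?_⟩
    have := h (x + -a)
    rw [neg_add_cancel_right, mul_add, mul_neg, Complex.exp_add, Complex.exp_neg] at this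
    rw [this, neg_mul, Complex.exp_neg]
    have h1 := Complex.exp_ne_zero (c * a)
    have h2 := Complex.exp_ne_zero (c * x)
    field_simp

lemma exists_theta_add {τ l : ℂ} (hτ : 0 < τ.im) (hl : l ∈ lattice τ) :
    ∃ K c : ℂ, K ≠ 0 ∧ ∀ x, theta (x + l) τ = K * Complex.exp (c * x) * theta x τ := by
  obtain ⟨a, b, rfl⟩ := hl
  have h1 : (1 : ℂ) ∈ quasiPeriods τ := ⟨-1, 0, by simp, fun x => by simp [theta_add_one]⟩
  have h2 : τ ∈ quasiPeriods τ := ⟨-Complex.exp (-(Real.pi * Complex.I * τ)),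
    -(2 * Real.pi * Complex.I), neg_ne_zero.mpr (Complex.exp_ne_zero _),
    fun x => theta_add_tau x hτ⟩
  have := (quasiPeriods τ).add_mem ((quasiPeriods τ).zsmul_mem h1 a)
    ((quasiPeriods τ).zsmul_mem h2 b)
  simp only [zsmul_eq_mul, mul_one] at this
  exact this

/-- A vanishing sine, or a vanishing factor 1 − w^{±1} q^{j+1}, puts x in the lattice. Conversely,
quasi-periodicity carries the zero at 0 to every lattice point. -/
lemma theta_eq_zero_iff {x τ : ℂ} (hτ : 0 < τ.im) : theta x τ = 0 ↔ x ∈ lattice τ := by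
  constructor
  · contrapose!
    intro hx
    have hq := norm_exp_two_pi_I_mul_lt_one hτ
    have hpi : (Real.pi : ℂ) ≠ 0 := by exact_mod_cast Real.pi_ne_zero
    have key : ∀ (k : ℤ) (y : ℂ), (y = x ∨ y = -x) →
        Complex.exp (2 * Real.pi * Complex.I * (y + k * τ)) ≠ 1 := by
      intro k y hy h
      rw [Complex.exp_eq_one_iff] at h
      obtain ⟨a, ha⟩ := h
      have h2 : y + k * τ = a := by
        have hI : (2 * Real.pi * Complex.I : ℂ) ≠ 0 := by simp [hpi]
        apply mul_left_cancel₀ hI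
        rw [ha]; ring
      apply hx
      rcases hy with rfl | rfl
      · exact ⟨a, -k, by push_cast; linear_combination h2⟩
      · exact ⟨-a, k, by push_cast; linear_combination -h2⟩
    have hpow : ∀ j : ℕ, Complex.exp (2 * Real.pi * Complex.I * τ) *
        Complex.exp (2 * Real.pi * Complex.I * τ) ^ j =
        Complex.exp (2 * Real.pi * Complex.I * (((j + 1 : ℕ) : ℤ) * τ)) := by
      intro j
      rw [← pow_succ', ← Complex.exp_nat_mul]
      congr 1
      push_cast
      ring
    simp only [theta]
    refine mul_ne_zero (mul_ne_zero (mul_ne_zero (div_ne_zero ?_ hpi) ?_) ?_)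
      (inv_ne_zero (pow_ne_zero _ ?_))
    · rw [Ne, Complex.sin_eq_zero_iff]
      rintro ⟨k, hk⟩
      apply hx
      refine ⟨k, 0, ?_⟩
      apply mul_left_cancel₀ hpi
      rw [hk]; push_cast; ring
    · refine qProd_ne_zero hq fun j => ?_
      rw [mul_right_comm, hpow, ← Complex.exp_add, ← mul_add, add_comm]
      exact key _ x (Or.inl rfl)
    · refine qProd_ne_zero hq fun j => ?_
      rw [div_mul_eq_mul_div, hpow, div_eq_mul_inv, ← Complex.exp_neg, ← Complex.exp_add,
        ← mul_neg, ← mul_add, add_comm]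
      exact key _ (-x) (Or.inr rfl)
    · refine qProd_ne_zero hq fun j hj => ?_
      have h1 : ‖Complex.exp (2 * Real.pi * Complex.I * τ) *
          Complex.exp (2 * Real.pi * Complex.I * τ) ^ j‖ < 1 := by
        rw [← pow_succ', norm_pow]
        exact pow_lt_one₀ (norm_nonneg _) hq (by simp)
      rw [hj] at h1
      simp at h1
  · intro hx
    obtain ⟨K, c, -, h⟩ := exists_theta_add hτ hx
    simpa [theta_zero] using h 0

/-- The derivative of `θ` in the first variable. -/
def dtheta (x τ : ℂ) : ℂ := deriv (fun y => theta y τ) x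

lemma hasDerivAt_theta {τ : ℂ} (hτ : 0 < τ.im) (x : ℂ) :
    HasDerivAt (fun y => theta y τ) (dtheta x τ) x := (differentiable_theta hτ x).hasDerivAt

lemma dtheta_zero {τ : ℂ} (hτ : 0 < τ.im) : dtheta 0 τ = 1 := (hasDerivAt_theta_zero hτ).deriv

lemma differentiable_dtheta {τ : ℂ} (hτ : 0 < τ.im) : Differentiable ℂ fun x => dtheta x τ :=
  (differentiable_theta hτ).deriv

/-- Differentiating θ(x + l) = K e^{cx} θ(x) at x = 0 gives θ'(l) = K. So all zeros of θ are simple,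
as dividing by theta functions requires. -/
lemma dtheta_ne_zero {τ l : ℂ} (hτ : 0 < τ.im) (hl : l ∈ lattice τ) : dtheta l τ ≠ 0 := by
  obtain ⟨K, c, hK, h⟩ := exists_theta_add hτ hl
  have h1 : HasDerivAt (fun x => theta (x + l) τ) (dtheta l τ) 0 := by
    have := hasDerivAt_theta hτ (0 + l)
    rw [zero_add] at this
    exact HasDerivAt.comp_add_const 0 l (by simpa using this)
  have h2 : HasDerivAt (fun x => K * Complex.exp (c * x) * theta x τ) K 0 := by
    have := (((hasDerivAt_id (0 : ℂ)).const_mul c).cexp.const_mul K).mul (hasDerivAt_theta_zero hτ)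
    refine this.congr_deriv ?_
    simp [theta_zero]
  rw [h1.unique (h2.congr_of_eventuallyEq (Eventually.of_forall h))]
  exact hK

lemma dtheta_neg {τ : ℂ} (x : ℂ) : dtheta (-x) τ = dtheta x τ := by
  unfold dtheta
  have h := deriv_comp_neg (fun y => theta y τ) x
  simp only [theta_neg, deriv.fun_neg] at h
  rw [← neg_neg (deriv (fun y => theta y τ) (-x)), ← h, neg_neg]

lemma dtheta_add_one (x τ : ℂ) : dtheta (x + 1) τ = -dtheta x τ := by
  unfold dtheta
  rw [← deriv_comp_add_const]
  simp only [theta_add_one, deriv.fun_neg]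

lemma dtheta_add_tau (x : ℂ) {τ : ℂ} (hτ : 0 < τ.im) :
    dtheta (x + τ) τ =
      -Complex.exp (-(Real.pi * Complex.I * τ)) * Complex.exp (-(2 * Real.pi * Complex.I) * x) *
        (dtheta x τ - 2 * Real.pi * Complex.I * theta x τ) := by
  have h1 : HasDerivAt (fun x => theta (x + τ) τ) (dtheta (x + τ) τ) x :=
    HasDerivAt.comp_add_const x τ (hasDerivAt_theta hτ (x + τ))
  have h2 := ((((hasDerivAt_id x).const_mul (-(2 * Real.pi * Complex.I))).cexp.const_mul
    (-Complex.exp (-(Real.pi * Complex.I * τ)))).mul (hasDerivAt_theta hτ x))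
  rw [h1.unique (h2.congr_of_eventuallyEq (Eventually.of_forall fun y => theta_add_tau y hτ))]
  simp only [id_eq]
  ring

/-! ### Elliptic functions and the addition theorem -/

/-- If the entire function `p` has only simple zeros and the entire function `f` vanishes at them,
then `f / p` is entire. -/
lemma exists_differentiable_mul_eq {f p : ℂ → ℂ} (hf : Differentiable ℂ f)
    (hp : Differentiable ℂ p) (hp' : ∀ a, p a = 0 → deriv p a ≠ 0)
    (hfp : ∀ a, p a = 0 → f a = 0) :
    ∃ h : ℂ → ℂ, Differentiable ℂ h ∧ ∀ a, f a = h a * p a := by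
  classical
  refine ⟨fun a => if p a = 0 then deriv f a / deriv p a else f a / p a, fun a => ?_, fun a => ?_⟩
  · by_cases ha : p a = 0
    · have hdf : Differentiable ℂ (dslope f a) := by
        rw [← differentiableOn_univ] at hf ⊢
        exact (Complex.differentiableOn_dslope univ_mem).mpr hf
      have hdp : Differentiable ℂ (dslope p a) := by
        rw [← differentiableOn_univ] at hp ⊢
        exact (Complex.differentiableOn_dslope univ_mem).mpr hp
      have hpa : dslope p a a ≠ 0 := by rw [dslope_same]; exact hp' a ha
      have hev : ∀ᶠ b in 𝓝 a, dslope p a b ≠ 0 :=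
        hdp.continuous.continuousAt.eventually_ne hpa
      -- Near a zero of `p` the quotient is that of the two slopes at `a`, and the slope of `p` does
      -- not vanish there.
      refine ((hdf a).div (hdp a) hpa).congr_of_eventuallyEq ?_
      filter_upwards [hev] with b hb
      by_cases hba : b = a
      · subst hba
        simp [ha]
      · have h1 : p b = (b - a) * dslope p a b := by
          have := sub_smul_dslope p a b
          rw [ha, sub_zero, smul_eq_mul] at this
          exact this.symm
        have h2 : f b = (b - a) * dslope f a b := by
          have := sub_smul_dslope f a b
          rw [hfp a ha, sub_zero, smul_eq_mul] at this
          exact this.symm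
        have h3 : b - a ≠ 0 := sub_ne_zero.mpr hba
        rw [Pi.div_apply, if_neg (by rw [h1]; exact mul_ne_zero h3 hb), h1, h2,
          mul_div_mul_left _ _ h3]
    · have hev : ∀ᶠ b in 𝓝 a, p b ≠ 0 := hp.continuous.continuousAt.eventually_ne ha
      refine ((hf a).div (hp a) ha).congr_of_eventuallyEq ?_
      filter_upwards [hev] with b hb
      rw [Pi.div_apply, if_neg hb]
  · by_cases ha : p a = 0
    · simp [ha, hfp a ha]
    · simp [ha]

/-- A doubly periodic entire function is constant. -/
lemma eq_of_doubly_periodic {h : ℂ → ℂ} {τ : ℂ} (hτ : 0 < τ.im) (hh : Differentiable ℂ h)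
    (h1 : ∀ a, h (a + 1) = h a) (h2 : ∀ a, h (a + τ) = h a) (a b : ℂ) : h a = h b := by
  refine hh.apply_eq_apply_of_bounded ?_ a b
  -- By periodicity the compact period parallelogram already carries all values of `h`, so `h` is
  -- bounded and Liouville's theorem applies.
  have hcomp : IsCompact ((fun r : ℝ × ℝ => h (r.1 + r.2 * τ)) '' (Icc 0 1 ×ˢ Icc 0 1)) := by
    refine (isCompact_Icc.prod isCompact_Icc).image ?_
    have := hh.continuous
    fun_prop
  refine hcomp.isBounded.subset ?_
  rintro _ ⟨x, rfl⟩
  have p1 : Function.Periodic h 1 := h1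
  have p2 : Function.Periodic h τ := h2
  set s : ℝ := x.im / τ.im
  set r : ℝ := x.re - s * τ.re
  have hx : x = r + s * τ := by
    apply Complex.ext
    · simp [r]
    · simp [s, hτ.ne']
  refine ⟨(Int.fract r, Int.fract s), ⟨⟨Int.fract_nonneg _, (Int.fract_lt_one _).le⟩,
    ⟨Int.fract_nonneg _, (Int.fract_lt_one _).le⟩⟩, ?_⟩
  have e : ((Int.fract r : ℝ) : ℂ) + ((Int.fract s : ℝ) : ℂ) * τ =
      x - (⌊s⌋ : ℤ) * τ - (⌊r⌋ : ℤ) * 1 := by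
    rw [hx, Int.fract, Int.fract]
    push_cast
    ring
  simp only
  rw [e, p1.sub_int_mul_eq, p2.sub_int_mul_eq]

/-- The addition theorem for `ρ`, cleared of denominators. -/
lemma theta_addition {τ : ℂ} (hτ : 0 < τ.im) {b c : ℂ} (hb : b ∉ lattice τ) (hc : c ∉ lattice τ)
    (hbc : b + c ∉ lattice τ) (a : ℂ) :
    theta b τ * theta c τ *
        (dtheta a τ * theta (a + (b + c)) τ - theta a τ * dtheta (a + (b + c)) τ) +
      theta a τ * theta (a + (b + c)) τ *
        (dtheta b τ * theta c τ + dtheta c τ * theta b τ) =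
      theta (a + b) τ * theta (b + c) τ * theta (a + c) τ := by
  set f : ℂ → ℂ := fun a => theta b τ * theta c τ *
        (dtheta a τ * theta (a + (b + c)) τ - theta a τ * dtheta (a + (b + c)) τ) +
      theta a τ * theta (a + (b + c)) τ *
        (dtheta b τ * theta c τ + dtheta c τ * theta b τ) -
      theta (a + b) τ * theta (b + c) τ * theta (a + c) τ with hf
  suffices h : f a = 0 by rw [← sub_eq_zero]; exact h
  -- As functions of `a`, `f` and `p` have the same multipliers. The zeros of `p` are simple because
  -- b + c is not in the lattice, and `f` vanishes at them. So f / p is elliptic without poles,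
  -- hence constant; its value at a = −b is 0.
  set p : ℂ → ℂ := fun a => theta a τ * theta (a + (b + c)) τ with hpdef
  have hθ := differentiable_theta hτ
  have hdθ := differentiable_dtheta hτ
  have hθs : ∀ s : ℂ, Differentiable ℂ fun a => theta (a + s) τ := fun s =>
    hθ.comp (g := fun y => theta y τ) (f := fun a => a + s) (by fun_prop)
  have hdθs : ∀ s : ℂ, Differentiable ℂ fun a => dtheta (a + s) τ := fun s =>
    hdθ.comp (g := fun y => dtheta y τ) (f := fun a => a + s) (by fun_prop)
  have hfd : Differentiable ℂ f := by
    have := hθs b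
    have := hθs c
    have := hθs (b + c)
    have := hdθs (b + c)
    fun_prop
  have hpd : Differentiable ℂ p := hθ.mul (hθs _)
  -- quasi-periodicity
  have hp1 : ∀ a, p (a + 1) = p a := fun a => by
    simp only [hpdef, add_right_comm a 1, theta_add_one]; ring
  have hf1 : ∀ a, f (a + 1) = f a := fun a => by
    simp only [hf, add_right_comm a 1, theta_add_one, dtheta_add_one]; ring
  set χ : ℂ → ℂ := fun a => -Complex.exp (-(Real.pi * Complex.I * τ)) *
    Complex.exp (-(2 * Real.pi * Complex.I) * a) with hχ
  have hχ0 : ∀ a, χ a ≠ 0 := fun a =>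
    mul_ne_zero (neg_ne_zero.mpr (Complex.exp_ne_zero _)) (Complex.exp_ne_zero _)
  have hθτ : ∀ a, theta (a + τ) τ = χ a * theta a τ := fun a => theta_add_tau a hτ
  have hdθτ : ∀ a, dtheta (a + τ) τ = χ a * (dtheta a τ - 2 * Real.pi * Complex.I * theta a τ) :=
    fun a => dtheta_add_tau a hτ
  have hχm : ∀ a, χ (a + b) * χ (a + c) = χ a * χ (a + (b + c)) := fun a => by
    simp only [hχ]
    simp only [mul_add, Complex.exp_add]
    ring
  have hpτ : ∀ a, p (a + τ) = χ a * χ (a + (b + c)) * p a := fun a => by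
    simp only [hpdef, add_right_comm a τ, hθτ]; ring
  have hfτ : ∀ a, f (a + τ) = χ a * χ (a + (b + c)) * f a := fun a => by
    simp only [hf, add_right_comm a τ, hθτ, hdθτ]
    linear_combination (-theta (a + b) τ * theta (b + c) τ * theta (a + c) τ) * hχm a
  -- zeros of `p`
  have hp0 : ∀ a, p a = 0 → a ∈ lattice τ ∨ a + (b + c) ∈ lattice τ := fun a ha => by
    rcases mul_eq_zero.mp ha with h | h
    · exact Or.inl ((theta_eq_zero_iff hτ).mp h)
    · exact Or.inr ((theta_eq_zero_iff hτ).mp h)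
  have hnot : ∀ a, a ∈ lattice τ → a + (b + c) ∉ lattice τ := fun a h h' => by
    apply hbc
    have := (latticeSubgroup τ).sub_mem h' h
    rwa [add_sub_cancel_left] at this
  have hpd' : ∀ a, deriv p a = dtheta a τ * theta (a + (b + c)) τ +
      theta a τ * dtheta (a + (b + c)) τ := fun a =>
    ((hasDerivAt_theta hτ a).mul (HasDerivAt.comp_add_const a (b + c)
      (hasDerivAt_theta hτ (a + (b + c))))).deriv
  have hp' : ∀ a, p a = 0 → deriv p a ≠ 0 := fun a ha => by
    rw [hpd' a]
    rcases hp0 a ha with h | h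
    · rw [(theta_eq_zero_iff hτ).mpr h, zero_mul, add_zero]
      exact mul_ne_zero (dtheta_ne_zero hτ h) (fun h' => hnot a h ((theta_eq_zero_iff hτ).mp h'))
    · rw [(theta_eq_zero_iff hτ).mpr h, mul_zero, zero_add]
      exact mul_ne_zero (fun h' => hnot a ((theta_eq_zero_iff hτ).mp h') h) (dtheta_ne_zero hτ h)
  have hf0 : f 0 = 0 ∧ f (-(b + c)) = 0 := by
    constructor
    · simp only [hf, zero_add, theta_zero, dtheta_zero hτ]; ring
    · simp only [hf, neg_add_cancel, theta_zero, dtheta_zero hτ,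
        show -(b + c) + b = -c by ring, show -(b + c) + c = -b by ring, theta_neg]
      ring
  -- the set of zeros of `f` is invariant under the lattice
  have hshift : ∀ l ∈ lattice τ, ∀ a, f a = 0 → f (a + l) = 0 := by
    let S : AddSubgroup ℂ :=
      { carrier := {l | ∀ a, f a = 0 ↔ f (a + l) = 0}
        zero_mem' := fun a => by simp
        add_mem' := fun {l l'} h h' a => by rw [h a, h' (a + l), add_assoc]
        neg_mem' := fun {l} h a => by rw [h (a + -l), neg_add_cancel_right] }
    have m1 : (1 : ℂ) ∈ S := fun a => by rw [hf1]
    have m2 : τ ∈ S := fun a => by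
      rw [hfτ, mul_eq_zero, mul_eq_zero]
      simp [hχ0]
    rintro _ ⟨i, j, rfl⟩ a ha
    have := S.add_mem (S.zsmul_mem m1 i) (S.zsmul_mem m2 j)
    simp only [zsmul_eq_mul, mul_one] at this
    exact (this a).mp ha
  have hfp : ∀ a, p a = 0 → f a = 0 := fun a ha => by
    rcases hp0 a ha with h | h
    · simpa using hshift a h 0 hf0.1
    · have := hshift _ h (-(b + c)) hf0.2
      rwa [neg_add_cancel_comm_assoc] at this
  obtain ⟨h, hh, hfh⟩ := exists_differentiable_mul_eq hfd hpd hp' hfp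
  have hdense : Dense {a | p a ≠ 0} := by
    have hc : {a | p a = 0}.Countable := by
      refine Countable.mono (s₂ := lattice τ ∪ (fun a => a - (b + c)) '' lattice τ) ?_
        ((countable_lattice τ).union ((countable_lattice τ).image _))
      intro a ha
      rcases hp0 a ha with h | h
      · exact Or.inl h
      · exact Or.inr ⟨_, h, by ring⟩
    exact hc.dense_compl ℂ
  have hper : ∀ l : ℂ, (∀ a, p a ≠ 0 → h (a + l) = h a) → ∀ a, h (a + l) = h a := fun l hl => by
    have := Continuous.ext_on hdense (f := fun a => h (a + l)) (g := h)
      (hh.continuous.comp (by fun_prop)) hh.continuous (fun a ha => hl a ha)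
    exact fun a => congrFun this a
  have hh1 : ∀ a, h (a + 1) = h a := hper 1 fun a ha => by
    have := hfh (a + 1)
    rw [hf1, hp1, hfh a] at this
    exact (mul_right_cancel₀ ha this).symm
  have hhτ : ∀ a, h (a + τ) = h a := hper τ fun a ha => by
    have := hfh (a + τ)
    rw [hfτ, hpτ, hfh a] at this
    have hne : χ a * χ (a + (b + c)) * p a ≠ 0 := mul_ne_zero (mul_ne_zero (hχ0 _) (hχ0 _)) ha
    refine (mul_right_cancel₀ hne ?_).symm
    linear_combination this
  have hconst := eq_of_doubly_periodic hτ hh hh1 hhτ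
  have hfb : f (-b) = 0 := by
    simp only [hf, neg_add_cancel, theta_zero, show -b + (b + c) = c by ring, theta_neg, dtheta_neg]
    ring
  have hpb : p (-b) ≠ 0 := by
    simp only [hpdef, show -b + (b + c) = c by ring, theta_neg]
    refine mul_ne_zero (neg_ne_zero.mpr ?_) ?_
    · rwa [Ne, theta_eq_zero_iff hτ]
    · rwa [Ne, theta_eq_zero_iff hτ]
  have h0 : h (-b) = 0 := by
    have := hfh (-b)
    rw [hfb] at this
    exact (mul_eq_zero.mp this.symm).resolve_right hpb
  rw [hfh a, hconst a (-b), h0, zero_mul]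

/-! ### Identities for `ρ` and `σ` -/

lemma rho_eq (x τ : ℂ) : rho x τ = dtheta x τ / theta x τ := rfl

lemma rho_neg (x τ : ℂ) : rho (-x) τ = -rho x τ := by
  rw [rho_eq, rho_eq, dtheta_neg, theta_neg, div_neg]

lemma isClosed_lattice {τ : ℂ} (hτ : 0 < τ.im) : IsClosed (lattice τ) := by
  have : lattice τ = (fun x => theta x τ) ⁻¹' {0} := by
    ext x
    simp [theta_eq_zero_iff hτ]
  rw [this]
  exact isClosed_singleton.preimage (differentiable_theta hτ).continuous

lemma eventually_notMem_lattice {x τ : ℂ} (hτ : 0 < τ.im) (hx : x ∉ lattice τ) :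
    ∀ᶠ y in 𝓝 x, y ∉ lattice τ := (isClosed_lattice hτ).isOpen_compl.mem_nhds hx

/-- The derivative of `σ` in the second variable. -/
def dsigma (u w τ : ℂ) : ℂ :=
  (dtheta (u + w) τ * theta w τ - theta (u + w) τ * dtheta w τ) / (theta u τ * theta w τ ^ 2)

lemma sigma_comm (u w τ : ℂ) : sigma u w τ = sigma w u τ := by
  rw [sigma, sigma, add_comm, mul_comm (theta u τ)]

lemma hasDerivAt_sigma {τ : ℂ} (hτ : 0 < τ.im) (u : ℂ) {w : ℂ} (hw : w ∉ lattice τ) :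
    HasDerivAt (fun v => sigma u v τ) (dsigma u w τ) w := by
  have hw0 : theta w τ ≠ 0 := fun h => hw ((theta_eq_zero_iff hτ).mp h)
  -- If θ(u) = 0, division by zero makes both `sigma u v τ` and `dsigma u w τ` equal to 0.
  by_cases hu : theta u τ = 0
  · simp only [sigma, dsigma, hu, zero_mul, div_zero]
    exact hasDerivAt_const _ _
  have h1 : HasDerivAt (fun v => theta (u + v) τ) (dtheta (u + w) τ) w :=
    HasDerivAt.comp_const_add u w (hasDerivAt_theta hτ (u + w))
  have h2 := h1.div ((hasDerivAt_theta hτ w).const_mul (theta u τ)) (mul_ne_zero hu hw0)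
  refine h2.congr_deriv ?_
  rw [dsigma]
  field_simp

lemma hasDerivAt_sigma_left {τ : ℂ} (hτ : 0 < τ.im) {u : ℂ} (w : ℂ) (hu : u ∉ lattice τ) :
    HasDerivAt (fun v => sigma v w τ) (dsigma w u τ) u := by
  simp only [fun v => sigma_comm v w τ]
  exact hasDerivAt_sigma hτ w hu

lemma sigma_neg_left (u w τ : ℂ) : sigma (-u) w τ = -sigma u (-w) τ := by
  rw [sigma, sigma, theta_neg, theta_neg w, show -u + w = -(u + -w) by ring, theta_neg]
  rw [neg_mul, neg_div_neg_eq, mul_neg, div_neg, neg_neg]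

lemma dsigma_neg_left (u w τ : ℂ) : dsigma (-u) w τ = dsigma u (-w) τ := by
  rw [dsigma, dsigma, theta_neg, theta_neg w, show -u + w = -(u + -w) by ring, theta_neg, dtheta_neg,
    dtheta_neg w, neg_sq, ← neg_div_neg_eq]
  congr 1 <;> ring

/-- The addition theorem for the triple (w, a, b), divided by its theta factors. -/
lemma sigma_mul_sigma {τ : ℂ} (hτ : 0 < τ.im) {a b w : ℂ} (ha : a ∉ lattice τ)
    (hb : b ∉ lattice τ) (hab : a + b ∉ lattice τ) (hw : w ∉ lattice τ) :
    sigma a w τ * sigma b w τ = sigma (a + b) w τ * (rho a τ + rho b τ) - dsigma (a + b) w τ := by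
  have h := theta_addition hτ ha hb hab w
  rw [← theta_eq_zero_iff hτ] at ha hb hab hw
  rw [sigma, sigma, sigma, dsigma, rho_eq, rho_eq, add_comm a w, add_comm b w, add_comm (a + b) w]
  field_simp
  linear_combination -h

lemma dsigma_sub_dsigma {τ : ℂ} (hτ : 0 < τ.im) {u w : ℂ} (hu : u ∉ lattice τ)
    (hw : w ∉ lattice τ) :
    dsigma u w τ - dsigma w u τ = sigma u w τ * (rho u τ - rho w τ) := by
  rw [← theta_eq_zero_iff hτ] at hu hw
  rw [dsigma, dsigma, sigma, rho_eq, rho_eq, add_comm w u]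
  field_simp
  ring

/-- This is `sigma_mul_sigma` at the pair (x − t, −x), solved for the term with ρ(x). It makes the
twisted derivative of a form at t a combination of the forms at t and at x. -/
lemma sigma_mul_rho {τ : ℂ} (hτ : 0 < τ.im) {x t w : ℂ} (hx : x ∉ lattice τ)
    (ht : t ∉ lattice τ) (hxt : x - t ∉ lattice τ) (hw : w ∉ lattice τ) :
    rho x τ * sigma t (-w) τ = dsigma t (-w) τ + rho (x - t) τ * sigma t (-w) τ -
      sigma (x - t) w τ * sigma x (-w) τ := by
  have h := sigma_mul_sigma hτ hxt (neg_mem_lattice_iff.not.mpr hx)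
    (by rw [sub_add_eq_add_sub, add_neg_cancel, zero_sub]; exact neg_mem_lattice_iff.not.mpr ht) hw
  rw [sub_add_eq_add_sub, add_neg_cancel, zero_sub, sigma_neg_left, sigma_neg_left, dsigma_neg_left,
    rho_neg] at h
  linear_combination -h

lemma differentiableAt_rho {τ : ℂ} (hτ : 0 < τ.im) {x : ℂ} (hx : x ∉ lattice τ) :
    DifferentiableAt ℂ (fun y => rho y τ) x :=
  (differentiable_dtheta hτ x).div (differentiable_theta hτ x)
    (fun h => hx ((theta_eq_zero_iff hτ).mp h))

/-- The derivative of `ρ`. -/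
def drho (x τ : ℂ) : ℂ := deriv (fun y => rho y τ) x

lemma hasDerivAt_rho {τ : ℂ} (hτ : 0 < τ.im) {x : ℂ} (hx : x ∉ lattice τ) :
    HasDerivAt (fun y => rho y τ) (drho x τ) x := (differentiableAt_rho hτ hx).hasDerivAt

lemma drho_eq {τ : ℂ} (hτ : 0 < τ.im) {x : ℂ} (hx : x ∉ lattice τ) :
    drho x τ = (deriv (fun y => dtheta y τ) x * theta x τ - dtheta x τ * dtheta x τ) /
      theta x τ ^ 2 :=
  ((differentiable_dtheta hτ x).hasDerivAt.div (hasDerivAt_theta hτ x)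
    (fun h => hx ((theta_eq_zero_iff hτ).mp h))).deriv

/-- The x-derivative of `sigma_mul_rho`; the term `dsigma t (-w) τ` there does not depend on x. -/
lemma drho_mul_sigma {τ : ℂ} (hτ : 0 < τ.im) {x t w : ℂ} (hx : x ∉ lattice τ)
    (ht : t ∉ lattice τ) (hxt : x - t ∉ lattice τ) (hw : w ∉ lattice τ) :
    drho x τ * sigma t (-w) τ = drho (x - t) τ * sigma t (-w) τ -
      dsigma w (x - t) τ * sigma x (-w) τ - sigma (x - t) w τ * dsigma (-w) x τ := by
  have h1 := (hasDerivAt_rho hτ hx).mul_const (sigma t (-w) τ)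
  have h2 := (((HasDerivAt.comp_sub_const x t (hasDerivAt_rho hτ hxt)).mul_const
    (sigma t (-w) τ)).const_add (dsigma t (-w) τ)).sub
    ((HasDerivAt.comp_sub_const x t (hasDerivAt_sigma_left hτ w hxt)).mul
      (hasDerivAt_sigma_left hτ (-w) hx))
  have hxt' : ∀ᶠ y in 𝓝 x, y - t ∉ lattice τ :=
    (continuous_id.sub continuous_const).continuousAt.eventually (eventually_notMem_lattice hτ hxt)
  have h3 := h1.unique (h2.congr_of_eventuallyEq (by
    filter_upwards [eventually_notMem_lattice hτ hx, hxt'] with y hy hyt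
    exact sigma_mul_rho hτ hy ht hyt hw))
  rw [h3]
  ring

/-- Both sides are continuous in c, and only countably many c were excluded. The excluded value c =
−b is the one used in `sigma_mul_sigma_neg`. -/
lemma theta_addition_of_notMem {τ : ℂ} (hτ : 0 < τ.im) {b : ℂ} (hb : b ∉ lattice τ) (a c : ℂ) :
    theta b τ * theta c τ *
        (dtheta a τ * theta (a + (b + c)) τ - theta a τ * dtheta (a + (b + c)) τ) +
      theta a τ * theta (a + (b + c)) τ *
        (dtheta b τ * theta c τ + dtheta c τ * theta b τ) =
      theta (a + b) τ * theta (b + c) τ * theta (a + c) τ := by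
  have hdense : Dense {c | c ∉ lattice τ ∧ b + c ∉ lattice τ} := by
    have hcount : (lattice τ ∪ (fun l => l - b) '' lattice τ).Countable :=
      (countable_lattice τ).union ((countable_lattice τ).image _)
    refine (hcount.dense_compl ℂ).mono fun c (hc : ¬ _) => ⟨fun h => hc (Or.inl h), fun h => hc (Or.inr
      ⟨_, h, by ring⟩)⟩
  have hθ := (differentiable_theta hτ).continuous
  have hdθ := (differentiable_dtheta hτ).continuous
  have e1 : Continuous fun c => theta (b + c) τ := hθ.comp (by fun_prop)
  have e2 : Continuous fun c => theta (a + c) τ := hθ.comp (by fun_prop)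
  have e3 : Continuous fun c => theta (a + (b + c)) τ := hθ.comp (by fun_prop)
  have e4 : Continuous fun c => dtheta (a + (b + c)) τ := hdθ.comp (by fun_prop)
  refine congrFun (Continuous.ext_on hdense (f := fun c => theta b τ * theta c τ *
        (dtheta a τ * theta (a + (b + c)) τ - theta a τ * dtheta (a + (b + c)) τ) +
      theta a τ * theta (a + (b + c)) τ *
        (dtheta b τ * theta c τ + dtheta c τ * theta b τ))
      (g := fun c => theta (a + b) τ * theta (b + c) τ * theta (a + c) τ) (by fun_prop)
      (by fun_prop) ?_) c
  intro c hc
  exact theta_addition hτ hb hc.1 hc.2 a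

/-- At c = −x both sides of the addition theorem for (w, x, c) vanish; equating their derivatives in
c there gives the identity. The product σ(x, w) σ(x, −w) is the coefficient with which [e_12, e_21]
enters e^+_12(x) e^+_21(x). -/
lemma sigma_mul_sigma_neg {τ : ℂ} (hτ : 0 < τ.im) {x w : ℂ} (hx : x ∉ lattice τ)
    (hw : w ∉ lattice τ) :
    sigma x w τ * sigma x (-w) τ = drho w τ - drho x τ := by
  have hdd : deriv (fun y => dtheta y τ) (-x) = -deriv (fun y => dtheta y τ) x := by
    have h := deriv_comp_neg (fun y => dtheta y τ) x
    simp only [dtheta_neg] at h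
    rw [h, neg_neg]
  have hd0 : HasDerivAt (fun y => dtheta y τ) (deriv (fun y => dtheta y τ) (-x)) (-x) :=
    (differentiable_dtheta hτ (-x)).hasDerivAt
  have t1 : HasDerivAt (fun c => theta (w + (x + c)) τ) (dtheta w τ) (-x) := by
    simp only [← add_assoc]
    refine HasDerivAt.comp_const_add (f := fun y => theta y τ) (w + x) (-x) ?_
    simpa using hasDerivAt_theta hτ w
  have t2 : HasDerivAt (fun c => dtheta (w + (x + c)) τ) (deriv (fun y => dtheta y τ) w) (-x) := by
    simp only [← add_assoc]
    refine HasDerivAt.comp_const_add (f := fun y => dtheta y τ) (w + x) (-x) ?_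
    simpa using (differentiable_dtheta hτ w).hasDerivAt
  have t3 : HasDerivAt (fun c => theta (x + c) τ) (dtheta 0 τ) (-x) := by
    refine HasDerivAt.comp_const_add (f := fun y => theta y τ) x (-x) ?_
    simpa using hasDerivAt_theta hτ 0
  have t4 : HasDerivAt (fun c => theta (w + c) τ) (dtheta (w + -x) τ) (-x) :=
    HasDerivAt.comp_const_add w (-x) (hasDerivAt_theta hτ (w + -x))
  have t0 := hasDerivAt_theta hτ (-x)
  have L := ((t0.const_mul (theta x τ)).mul
    ((t1.const_mul (dtheta w τ)).sub (t2.const_mul (theta w τ)))).add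
    ((t1.const_mul (theta w τ)).mul ((t0.const_mul (dtheta x τ)).add (hd0.mul_const (theta x τ))))
  have R := (t3.const_mul (theta (w + x) τ)).mul t4
  have h := L.unique (R.congr_of_eventuallyEq (Eventually.of_forall fun c =>
    theta_addition_of_notMem hτ hx w c))
  simp only [Pi.sub_apply, Pi.add_apply, add_zero, dtheta_neg, theta_neg, hdd, add_neg_cancel,
    dtheta_zero hτ, theta_zero] at h
  rw [drho_eq hτ hx, drho_eq hτ hw, sigma, sigma, theta_neg w, show x + -w = -(w + -x) by ring,
    theta_neg, add_comm x w]
  rw [← theta_eq_zero_iff hτ] at hx hw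
  field_simp
  linear_combination -h

/-! ### The polynomial model of the tensor product -/

section Polynomial

open MvPolynomial

variable {n : ℕ}

lemma derivation_prod {R A ι : Type*} [CommSemiring R] [CommSemiring A] [Algebra R A]
    [DecidableEq ι] (D : Derivation R A A) (s : Finset ι) (f : ι → A) :
    D (∏ i ∈ s, f i) = ∑ i ∈ s, D (f i) * ∏ j ∈ s.erase i, f j := by
  induction s using Finset.induction_on with
  | empty => simp
  | insert a s ha ih =>
    rw [Finset.prod_insert ha, D.leibniz, ih, Finset.sum_insert ha, Finset.erase_insert ha,
      smul_eq_mul, smul_eq_mul, Finset.mul_sum, add_comm, mul_comm]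
    congr 1
    refine Finset.sum_congr rfl fun i hi => ?_
    rw [Finset.erase_insert_of_ne (by rintro rfl; exact ha hi),
      Finset.prod_insert (fun h => ha (Finset.mem_of_mem_erase h))]
    ring

/-- `r` is the value at `w` of `∂_w + ∑_s g_s X_s ∂_{X_s}` on the family of polynomials `p`. -/
def HasTwistedDeriv (g : Fin n → ℂ) (p : ℂ → MvPolynomial (Fin n) ℂ)
    (r : MvPolynomial (Fin n) ℂ) (w : ℂ) : Prop :=
  ∀ k, HasDerivAt (fun v => coeff k (p v)) (coeff k r - (∑ s, (k s : ℂ) * g s) * coeff k (p w)) w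

namespace HasTwistedDeriv

variable {g : Fin n → ℂ} {p p' : ℂ → MvPolynomial (Fin n) ℂ} {r r' : MvPolynomial (Fin n) ℂ}
  {w : ℂ}

lemma congr_deriv (h : HasTwistedDeriv g p r w) (e : r = r') : HasTwistedDeriv g p r' w := e ▸ h

lemma sub (h : HasTwistedDeriv g p r w) (h' : HasTwistedDeriv g p' r' w) :
    HasTwistedDeriv g (fun v => p v - p' v) (r - r') w := fun k => by
  simp only [coeff_sub]
  exact ((h k).sub (h' k)).congr_deriv (by ring)

/-- The twist ∑ k_s g_s is additive in the exponent k, so the twisted operator is a derivation. -/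
lemma mul (h : HasTwistedDeriv g p r w) (h' : HasTwistedDeriv g p' r' w) :
    HasTwistedDeriv g (fun v => p v * p' v) (r * p' w + p w * r') w := fun k => by
  classical
  simp only [coeff_mul, coeff_add]
  have := HasDerivAt.fun_sum (u := Finset.HasAntidiagonal.antidiagonal k) fun x _ => (h x.1).mul (h' x.2)
  refine this.congr_deriv ?_
  rw [← Finset.sum_add_distrib, Finset.mul_sum, ← Finset.sum_sub_distrib]
  refine Finset.sum_congr rfl fun x hx => ?_
  have hk : ∀ s, (k s : ℂ) = x.1 s + x.2 s := fun s => by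
    rw [← Finset.HasAntidiagonal.mem_antidiagonal.mp hx]
    simp
  simp only [hk, add_mul, Finset.sum_add_distrib]
  ring

lemma const_C {f : ℂ → ℂ} {f' : ℂ} (h : HasDerivAt f f' w) :
    HasTwistedDeriv g (fun v => C (f v)) (C f') w := fun k => by
  classical
  simp only [coeff_C]
  by_cases hk : 0 = k
  · subst hk
    simpa using h
  · simpa [hk] using hasDerivAt_const w (0 : ℂ)

lemma const_X (s : Fin n) : HasTwistedDeriv g (fun _ => X s) (C (g s) * X s) w := fun k => by
  classical
  simp only [coeff_C_mul, coeff_X]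
  refine (hasDerivAt_const w _).congr_deriv ?_
  by_cases hk : Finsupp.single s 1 = k
  · subst hk
    simp [Finsupp.single_apply]
  · simp [hk]

lemma sum {ι : Type*} {I : Finset ι} {p : ι → ℂ → MvPolynomial (Fin n) ℂ}
    {r : ι → MvPolynomial (Fin n) ℂ} (h : ∀ i ∈ I, HasTwistedDeriv g (p i) (r i) w) :
    HasTwistedDeriv g (fun v => ∑ i ∈ I, p i v) (∑ i ∈ I, r i) w := fun k => by
  simp only [coeff_sum]
  refine (HasDerivAt.fun_sum fun i hi => h i hi k).congr_deriv ?_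
  rw [Finset.sum_sub_distrib, Finset.mul_sum]

lemma prod {ι : Type*} [DecidableEq ι] {I : Finset ι} {p : ι → ℂ → MvPolynomial (Fin n) ℂ}
    {r : ι → MvPolynomial (Fin n) ℂ} (h : ∀ i ∈ I, HasTwistedDeriv g (p i) (r i) w) :
    HasTwistedDeriv g (fun v => ∏ i ∈ I, p i v) (∑ i ∈ I, r i * ∏ j ∈ I.erase i, p j w) w := by
  induction I using Finset.induction_on with
  | empty => simpa using! const_C (g := g) (hasDerivAt_const w (1 : ℂ))
  | insert a s ha ih =>
    have := (h a (Finset.mem_insert_self a s)).mul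
      (ih fun i hi => h i (Finset.mem_insert_of_mem hi))
    simp only [Finset.prod_insert ha]
    refine this.congr_deriv ?_
    rw [Finset.sum_insert ha, Finset.erase_insert ha, Finset.mul_sum]
    congr 1
    refine Finset.sum_congr rfl fun i hi => ?_
    rw [Finset.erase_insert_of_ne (by rintro rfl; exact ha hi),
      Finset.prod_insert (fun h => ha (Finset.mem_of_mem_erase h))]
    ring

end HasTwistedDeriv

/-- The exponent of the monomial that corresponds to a basis vector. -/
def exponent {m : Fin n → ℕ} (k : (s : Fin n) → Fin (m s + 1)) : Fin n →₀ ℕ :=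
  Finsupp.equivFunOnFinite.symm fun s => (k s : ℕ)

@[simp]
lemma exponent_apply {m : Fin n → ℕ} (k : (s : Fin n) → Fin (m s + 1)) (s : Fin n) :
    exponent k s = k s := rfl

/-- The projection of the tensor product of Verma modules, realized as the space of polynomials,
onto the tensor product of irreducible modules. -/
def proj (m : Fin n → ℕ) (p : MvPolynomial (Fin n) ℂ) : TensorSpace m :=
  fun k => coeff (exponent k) p

/-- The operator `e_{12}` on the Verma module of highest weight `m` in the `s`-th factor. -/
def raisePoly (m : ℕ) (s : Fin n) (p : MvPolynomial (Fin n) ℂ) : MvPolynomial (Fin n) ℂ :=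
  C (m : ℂ) * pderiv s p - X s * pderiv s (pderiv s p)

/-! ### The action of gl₂ on coefficients of polynomials. -/

lemma coeff_X_mul_pderiv (s : Fin n) (p : MvPolynomial (Fin n) ℂ) (k : Fin n →₀ ℕ) :
    coeff k (X s * pderiv s p) = k s * coeff k p := by
  classical
  rw [coeff_X_mul', coeff_pderiv]
  split_ifs with h
  · have hk : k s ≠ 0 := Finsupp.mem_support_iff.mp h
    have hle : Finsupp.single s 1 ≤ k := by
      rw [Finsupp.single_le_iff]; omega
    rw [tsub_add_cancel_of_le hle, mul_comm]
    simp only [Finsupp.tsub_apply, Finsupp.single_eq_same]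
    rw [← Nat.cast_add_one, Nat.sub_add_cancel (by omega)]
  · rw [Finsupp.notMem_support_iff.mp h]; simp

lemma coeff_raisePoly (m : ℕ) (s : Fin n) (p : MvPolynomial (Fin n) ℂ) (k : Fin n →₀ ℕ) :
    coeff k (raisePoly m s p) =
      (k s + 1) * (m - k s) * coeff (k + Finsupp.single s 1) p := by
  rw [raisePoly, coeff_sub, coeff_C_mul, coeff_X_mul_pderiv, coeff_pderiv]
  ring

lemma siteOp_apply (m : Fin n → ℕ) (s : Fin n) (A : Matrix (Fin (m s + 1)) (Fin (m s + 1)) ℂ)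
    (v : TensorSpace m) (k : (s : Fin n) → Fin (m s + 1)) :
    siteOp m s A v k = ∑ b, A (k s) b * v (Function.update k s b) := rfl

lemma eSite_one_zero_proj (m : Fin n → ℕ) (s : Fin n) (p : MvPolynomial (Fin n) ℂ) :
    eSite m 1 0 s (proj m p) = proj m (X s * p) := by
  classical
  funext k
  rw [eSite, siteOp_apply]
  simp only [glMat, proj, coeff_X_mul', lowerMat, Matrix.of_apply, Matrix.cons_val', Matrix.cons_val_zero,
    Matrix.cons_val_one, Matrix.cons_val_fin_one]
  split_ifs with h
  · have hk : (k s : ℕ) ≠ 0 := Finsupp.mem_support_iff.mp h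
    have hlt := (k s).isLt
    rw [Finset.sum_eq_single (⟨k s - 1, by omega⟩ : Fin (m s + 1))]
    · rw [if_pos (by simp only; omega), one_mul]
      congr 1
      ext s'
      by_cases hs : s' = s
      · subst hs; simp
      · simp [hs]
    · intro b _ hb
      rw [if_neg, zero_mul]
      intro h'
      apply hb
      ext
      simp only
      omega
    · simp
  · have hk : (k s : ℕ) = 0 := Finsupp.notMem_support_iff.mp h
    refine Finset.sum_eq_zero fun b _ => ?_
    rw [if_neg (by omega), zero_mul]

lemma eSite_zero_one_proj (m : Fin n → ℕ) (s : Fin n) (p : MvPolynomial (Fin n) ℂ) :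
    eSite m 0 1 s (proj m p) = proj m (raisePoly (m s) s p) := by
  classical
  funext k
  rw [eSite, siteOp_apply]
  simp only [glMat, proj, coeff_raisePoly, raiseMat, Matrix.of_apply, Matrix.cons_val',
    Matrix.cons_val_zero, Matrix.cons_val_one, Matrix.cons_val_fin_one, exponent_apply]
  have hlt := (k s).isLt
  -- At the top exponent the factor m_s − k_s vanishes, so monomials of exponent m_s + 1, which
  -- `proj` discards, contribute nothing. This is why the projection intertwines e_12.
  by_cases h : (k s : ℕ) = m s
  · rw [h, sub_self, mul_zero, zero_mul]
    refine Finset.sum_eq_zero fun b _ => ?_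
    have := b.isLt
    rw [if_neg (by omega), zero_mul]
  · rw [Finset.sum_eq_single (⟨k s + 1, by omega⟩ : Fin (m s + 1))]
    · rw [if_pos rfl]
      congr 1
      · push_cast; ring
      · congr 1
        ext s'
        by_cases hs : s' = s
        · subst hs; simp
        · simp [hs]
    · intro b _ hb
      rw [if_neg, zero_mul]
      intro h'
      exact hb (Fin.ext h')
    · simp

lemma eSite_zero_zero_apply (m : Fin n → ℕ) (s : Fin n) (v : TensorSpace m)
    (k : (s : Fin n) → Fin (m s + 1)) :
    eSite m 0 0 s v k = ((m s : ℂ) - 2 * (k s : ℕ)) / 2 * v k := by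
  rw [eSite, siteOp_apply, Finset.sum_eq_single (k s)]
  · simp [glMat, weightMat]
    left
    ring
  · intro b _ hb
    simp [glMat, weightMat, Matrix.diagonal_apply_ne _ hb.symm]
  · simp

lemma eSite_one_one_apply (m : Fin n → ℕ) (s : Fin n) (v : TensorSpace m)
    (k : (s : Fin n) → Fin (m s + 1)) :
    eSite m 1 1 s v k = -(((m s : ℂ) - 2 * (k s : ℕ)) / 2 * v k) := by
  rw [eSite, siteOp_apply, Finset.sum_eq_single (k s)]
  · simp [glMat, weightMat]
    left
    ring
  · intro b _ hb
    simp [glMat, weightMat, Matrix.diagonal_apply_ne _ hb.symm]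
  · simp

/-- The linear form `∑_s c_s X_s`. -/
def linForm (c : Fin n → ℂ) : MvPolynomial (Fin n) ℂ := ∑ s, C (c s) * X s

lemma linForm_add (c d : Fin n → ℂ) : linForm (c + d) = linForm c + linForm d := by
  simp [linForm, add_mul, Finset.sum_add_distrib]

lemma linForm_smul (a : ℂ) (c : Fin n → ℂ) : linForm (a • c) = C a * linForm c := by
  simp [linForm, Finset.mul_sum, mul_assoc]

lemma pderiv_linForm (s : Fin n) (c : Fin n → ℂ) : pderiv s (linForm c) = C (c s) := by
  simp only [linForm, map_sum, pderiv_C_mul, pderiv_X, Pi.single_apply, mul_ite, mul_one, mul_zero]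
  simp

lemma HasTwistedDeriv.linForm {g : Fin n → ℂ} {c : ℂ → Fin n → ℂ} {c' : Fin n → ℂ} {w : ℂ}
    (h : ∀ s, HasDerivAt (fun v => c v s) (c' s) w) :
    HasTwistedDeriv g (fun v => linForm (c v)) (linForm fun s => c' s + g s * c w s) w := by
  refine (HasTwistedDeriv.sum (I := Finset.univ) fun s _ =>
    (HasTwistedDeriv.const_C (g := g) (h s)).mul (HasTwistedDeriv.const_X s)).congr_deriv ?_
  refine Finset.sum_congr rfl fun s _ => ?_
  simp only [C_add, C_mul]
  ring

lemma raisePoly_prod {M : ℕ} (m : ℕ) (s : Fin n) (c : Fin M → Fin n → ℂ) :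
    raisePoly m s (∏ i, linForm (c i)) =
      C (m : ℂ) * ∑ i, C (c i s) * ∏ j ∈ Finset.univ.erase i, linForm (c j) -
        X s * ∑ i, ∑ j ∈ Finset.univ.erase i, C (c i s) * C (c j s) *
          ∏ l ∈ (Finset.univ.erase i).erase j, linForm (c l) := by
  rw [raisePoly, derivation_prod]
  simp only [pderiv_linForm, map_sum, pderiv_C_mul, derivation_prod, Finset.mul_sum, mul_assoc]

lemma raisePoly_C_mul (m : ℕ) (s : Fin n) (a : ℂ) (p : MvPolynomial (Fin n) ℂ) :
    raisePoly m s (C a * p) = C a * raisePoly m s p := by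
  simp only [raisePoly, pderiv_C_mul]
  ring

/-- The relation [e_12, e_21] = e_11 − e_22 in the Verma module: the Cartan element acts as m − 2
X_s ∂_s. -/
lemma raisePoly_linForm_mul (m : ℕ) (s : Fin n) (c : Fin n → ℂ) (p : MvPolynomial (Fin n) ℂ) :
    raisePoly m s (linForm c * p) = linForm c * raisePoly m s p +
      C (c s) * (C (m : ℂ) * p - 2 * (X s * pderiv s p)) := by
  simp only [raisePoly, pderiv_mul, pderiv_linForm, map_add, pderiv_C]
  ring

end Polynomial

/-! ### The polynomial form of the eigenvalue equation -/

section Eigen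

open MvPolynomial

variable {n M : ℕ}

/-- The coefficients of the linear form by which `∑_s σ(y - z_s, -w) e_{21}^{(s)}` acts. -/
def lowerCoeff (z : Fin n → ℂ) (τ y w : ℂ) : Fin n → ℂ := fun s => sigma (y - z s) (-w) τ

/-- The linear form by which `∑_s σ(y - z_s, -w) e_{21}^{(s)}` acts. -/
def lowerForm (z : Fin n → ℂ) (τ y w : ℂ) : MvPolynomial (Fin n) ℂ := linForm (lowerCoeff z τ y w)

/-- The derivative of `lowerForm` in `y`. -/
def lowerForm' (z : Fin n → ℂ) (τ y w : ℂ) : MvPolynomial (Fin n) ℂ :=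
  linForm fun s => dsigma (-w) (y - z s) τ

lemma sigma_mul_sigma_neg_right {τ : ℂ} (hτ : 0 < τ.im) {x t w : ℂ} (hx : x ∉ lattice τ)
    (ht : t ∉ lattice τ) (hxt : x - t ∉ lattice τ) (hw : w ∉ lattice τ) :
    sigma x w τ * sigma t (-w) τ =
      sigma (x - t) w τ * (rho t τ - rho x τ) + dsigma (x - t) w τ := by
  have h := sigma_mul_sigma hτ hx (neg_mem_lattice_iff.not.mpr ht)
    (by rwa [← sub_eq_add_neg]) hw
  rw [← sub_eq_add_neg, rho_neg, sigma_neg_left] at h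
  linear_combination -h

lemma hasDerivAt_sigma_neg {τ : ℂ} (hτ : 0 < τ.im) (u : ℂ) {w : ℂ} (hw : w ∉ lattice τ) :
    HasDerivAt (fun v => sigma u (-v) τ) (-dsigma u (-w) τ) w := by
  have h := HasDerivAt.comp w (hasDerivAt_sigma hτ u (neg_mem_lattice_iff.not.mpr hw))
    (hasDerivAt_neg w)
  exact h.congr_deriv (by ring)

lemma HasTwistedDeriv.exp_mul {g : Fin n → ℂ} {w : ℂ} (μ : ℂ) {p : ℂ → MvPolynomial (Fin n) ℂ}
    {r : MvPolynomial (Fin n) ℂ} (hp : HasTwistedDeriv g p r w) :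
    HasTwistedDeriv g
      (fun v => C (Complex.exp (Real.pi * Complex.I * μ * v)) * p v)
      (C (Complex.exp (Real.pi * Complex.I * μ * w)) *
        (C (Real.pi * Complex.I * μ) * p w + r)) w := by
  have h : HasDerivAt (fun v => Complex.exp (Real.pi * Complex.I * μ * v))
      (Complex.exp (Real.pi * Complex.I * μ * w) * (Real.pi * Complex.I * μ)) w := by
    simpa using ((hasDerivAt_id w).const_mul (Real.pi * Complex.I * μ)).cexp
  refine ((HasTwistedDeriv.const_C h).mul hp).congr_deriv ?_
  rw [C_mul]
  ring

variable {τ : ℂ} (hτ : 0 < τ.im) {z : Fin n → ℂ} {x w : ℂ}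
  (hx : ∀ s, x - z s ∉ lattice τ) (hw : w ∉ lattice τ)

include hτ hx hw

/-- Coefficientwise this is `sigma_mul_rho`: its `dsigma` term cancels the w-derivative of the
coefficient. -/
lemma hasTwistedDeriv_lowerForm {y : ℂ} (hy : ∀ s, y - z s ∉ lattice τ) (hxy : x - y ∉ lattice τ) :
    HasTwistedDeriv (fun s => rho (x - z s) τ) (fun v => lowerForm z τ y v)
      (C (rho (x - y) τ) * lowerForm z τ y w - C (sigma (x - y) w τ) * lowerForm z τ x w) w := by
  refine (HasTwistedDeriv.linForm (c := fun v => lowerCoeff z τ y v) fun s =>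
    hasDerivAt_sigma_neg hτ _ hw).congr_deriv ?_
  rw [lowerForm, lowerForm, ← linForm_smul, sub_eq_add_neg, ← neg_mul, ← C_neg, ← linForm_smul,
    ← linForm_add]
  congr 1
  funext s
  have h := sigma_mul_rho hτ (hx s) (hy s) (by rwa [sub_sub_sub_cancel_right]) hw
  rw [sub_sub_sub_cancel_right] at h
  simp only [lowerCoeff, Pi.add_apply, Pi.smul_apply, smul_eq_mul]
  linear_combination h

/-- At y = x the coefficients of the previous formula are singular. Here `dsigma_sub_dsigma` trades
the derivative in w for the derivative in x. -/
lemma hasTwistedDeriv_lowerForm_self :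
    HasTwistedDeriv (fun s => rho (x - z s) τ) (fun v => lowerForm z τ x v)
      (-lowerForm' z τ x w - C (rho w τ) * lowerForm z τ x w) w := by
  refine (HasTwistedDeriv.linForm (c := fun v => lowerCoeff z τ x v) fun s =>
    hasDerivAt_sigma_neg hτ _ hw).congr_deriv ?_
  have e : -lowerForm' z τ x w - C (rho w τ) * lowerForm z τ x w =
      C (-1) * lowerForm' z τ x w + C (-rho w τ) * lowerForm z τ x w := by
    simp only [C_neg, C_1]; ring
  rw [e, lowerForm, lowerForm', ← linForm_smul, ← linForm_smul, ← linForm_add]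
  congr 1
  funext s
  have h := dsigma_sub_dsigma hτ (hx s) (neg_mem_lattice_iff.not.mpr hw)
  rw [rho_neg] at h
  simp only [lowerCoeff, Pi.add_apply, Pi.smul_apply, smul_eq_mul]
  linear_combination -h

variable {t : Fin M → ℂ} (ht : ∀ i s, t i - z s ∉ lattice τ) (hxt : ∀ i, x - t i ∉ lattice τ)

include ht hxt

lemma hasTwistedDeriv_prod (I : Finset (Fin M)) :
    HasTwistedDeriv (fun s => rho (x - z s) τ) (fun v => ∏ i ∈ I, lowerForm z τ (t i) v)
      (C (∑ i ∈ I, rho (x - t i) τ) * ∏ i ∈ I, lowerForm z τ (t i) w -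
        lowerForm z τ x w * ∑ i ∈ I, C (sigma (x - t i) w τ) *
          ∏ j ∈ I.erase i, lowerForm z τ (t j) w) w := by
  refine (HasTwistedDeriv.prod fun i _ =>
    hasTwistedDeriv_lowerForm hτ hx hw (ht i) (hxt i)).congr_deriv ?_
  rw [map_sum, Finset.sum_mul, Finset.mul_sum, ← Finset.sum_sub_distrib]
  refine Finset.sum_congr rfl fun i hi => ?_
  rw [← Finset.mul_prod_erase I (fun i => lowerForm z τ (t i) w) hi]
  ring

/-- The operator ∑ ρ'(x − z_s) X_s ∂_s is a derivation, so it acts on one factor at a time, and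
there `drho_mul_sigma` applies to each coefficient. -/
lemma sum_drho_mul_pderiv :
    ∑ s, C (drho (x - z s) τ) * (X s * pderiv s (∏ i, lowerForm z τ (t i) w)) =
      C (∑ i, drho (x - t i) τ) * ∏ i, lowerForm z τ (t i) w -
        lowerForm z τ x w * ∑ i, C (dsigma w (x - t i) τ) *
          ∏ j ∈ Finset.univ.erase i, lowerForm z τ (t j) w -
        lowerForm' z τ x w * ∑ i, C (sigma (x - t i) w τ) *
          ∏ j ∈ Finset.univ.erase i, lowerForm z τ (t j) w := by
  have key : ∀ i, linForm (fun s => drho (x - z s) τ * lowerCoeff z τ (t i) w s) =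
      C (drho (x - t i) τ) * lowerForm z τ (t i) w -
        C (dsigma w (x - t i) τ) * lowerForm z τ x w -
        C (sigma (x - t i) w τ) * lowerForm' z τ x w := fun i => by
    rw [sub_eq_add_neg, sub_eq_add_neg, ← neg_mul, ← neg_mul, ← C_neg, ← C_neg, lowerForm,
      lowerForm, lowerForm', ← linForm_smul, ← linForm_smul, ← linForm_smul, ← linForm_add,
      ← linForm_add]
    congr 1
    funext s
    have h := drho_mul_sigma hτ (hx s) (ht i s)
      (by rw [sub_sub_sub_cancel_right]; exact hxt i) hw
    rw [sub_sub_sub_cancel_right] at h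
    simp only [lowerCoeff, Pi.add_apply, Pi.smul_apply, smul_eq_mul]
    linear_combination h
  have e : ∑ s, C (drho (x - z s) τ) * (X s * pderiv s (∏ i, lowerForm z τ (t i) w)) =
      ∑ i, linForm (fun s => drho (x - z s) τ * lowerCoeff z τ (t i) w s) *
        ∏ j ∈ Finset.univ.erase i, lowerForm z τ (t j) w := by
    simp only [derivation_prod, Finset.mul_sum]
    rw [Finset.sum_comm]
    refine Finset.sum_congr rfl fun i _ => ?_
    rw [linForm, Finset.sum_mul]
    refine Finset.sum_congr rfl fun s _ => ?_
    rw [lowerForm, pderiv_linForm, C_mul]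
    ring
  rw [e, map_sum, Finset.sum_mul, Finset.mul_sum, Finset.mul_sum, ← Finset.sum_sub_distrib,
    ← Finset.sum_sub_distrib]
  refine Finset.sum_congr rfl fun i _ => ?_
  rw [key, ← Finset.mul_prod_erase Finset.univ (fun i => lowerForm z τ (t i) w)
    (Finset.mem_univ i)]
  ring

variable {m : Fin n → ℕ} (hm : ∑ s, m s = 2 * M) {μ : ℂ} (hB : IsBetheSolution m μ t z τ)

include hm hB

/-- The action of e^+_12(x) on the product. A second-order operator removes one factor, or two
factors at the cost of a new linear form. Expressing that form through ℓ_i, ℓ_j and ℓ_x returns one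
removed factor or splits off ℓ_x, and the Bethe equations simplify the coefficients of the products
with one factor missing. -/
lemma sum_sigma_mul_raisePoly :
    ∑ s, C (sigma (x - z s) w τ) * raisePoly (m s) s (∏ i, lowerForm z τ (t i) w) =
      ∑ i, C (2 * (sigma (x - t i) w τ * (Real.pi * Complex.I * μ + ∑ j, rho (x - t j) τ -
          1 / 2 * ∑ s, (m s : ℂ) * rho (x - z s) τ - rho (x - t i) τ) +
          dsigma (x - t i) w τ)) * ∏ j ∈ Finset.univ.erase i, lowerForm z τ (t j) w -
        lowerForm z τ x w * ∑ i, ∑ j ∈ Finset.univ.erase i,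
          C (sigma (x - t i) w τ) * C (sigma (x - t j) w τ) *
            ∏ l ∈ (Finset.univ.erase i).erase j, lowerForm z τ (t l) w := by
  set c : Fin M → Fin n → ℂ := fun i => lowerCoeff z τ (t i) w with hc
  set ℓ : Fin M → MvPolynomial (Fin n) ℂ := fun i => lowerForm z τ (t i) w with hℓ
  set P1 : Fin M → MvPolynomial (Fin n) ℂ := fun i => ∏ j ∈ Finset.univ.erase i, ℓ j with hP1
  set P2 : Fin M → Fin M → MvPolynomial (Fin n) ℂ :=
    fun i j => ∏ l ∈ (Finset.univ.erase i).erase j, ℓ l with hP2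
  set S : Fin M → ℂ := fun i => sigma (x - t i) w τ with hS
  set S2 : Fin M → Fin M → ℂ := fun i j => sigma (t i - t j) w τ with hS2
  have hne : ∀ {i j : Fin M}, j ∈ Finset.univ.erase i → i ≠ j := fun h =>
    (Finset.ne_of_mem_erase h).symm
  -- the product `σ σ`
  have hσc : ∀ i s, sigma (x - z s) w τ * c i s =
      S i * (rho (t i - z s) τ - rho (x - z s) τ) + dsigma (x - t i) w τ := fun i s => by
    have h := sigma_mul_sigma_neg_right hτ (hx s) (ht i s)
      (by rw [sub_sub_sub_cancel_right]; exact hxt i) hw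
    rwa [sub_sub_sub_cancel_right] at h
  -- After `hσc` each term is ρ or a constant times `c j s`; `sigma_mul_rho` at x and at t_i then
  -- resolves the two terms with ρ.
  have hσcc : ∀ i j, i ≠ j → linForm (fun s => sigma (x - z s) w τ * c i s * c j s) =
      C (S i * (rho (t i - t j) τ - rho (x - t j) τ) + dsigma (x - t i) w τ) * ℓ j -
        C (S i * S2 i j) * ℓ i + C (S i * S j) * lowerForm z τ x w := fun i j hij => by
    rw [sub_eq_add_neg, ← neg_mul, ← C_neg]
    simp only [hℓ, lowerForm]
    rw [← linForm_smul, ← linForm_smul, ← linForm_smul, ← linForm_add, ← linForm_add]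
    congr 1
    funext s
    have h1 := sigma_mul_rho hτ (hx s) (ht j s)
      (by rw [sub_sub_sub_cancel_right]; exact hxt j) hw
    have h2 := sigma_mul_rho hτ (ht i s) (ht j s)
      (by rw [sub_sub_sub_cancel_right]; exact hB.t_sub_t i j hij) hw
    rw [sub_sub_sub_cancel_right] at h1 h2
    rw [hσc]
    simp only [hc, hS, hS2, lowerCoeff, Pi.add_apply, Pi.smul_apply, smul_eq_mul]
    linear_combination sigma (x - t i) w τ * (h2 - h1)
  have hSS : ∀ i j, i ≠ j → S j * S2 j i =
      S i * (rho (x - t j) τ - rho (t i - t j) τ) - dsigma (x - t i) w τ := fun i j hij => by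
    have h := sigma_mul_sigma hτ (hxt j) (hB.t_sub_t j i hij.symm)
      (by rw [sub_add_sub_cancel]; exact hxt i) hw
    rw [sub_add_sub_cancel, ← neg_sub (t i) (t j), rho_neg, neg_sub] at h
    simp only [hS, hS2]
    linear_combination h
  -- expansion of the sum
  have e1 : ∑ s, C (sigma (x - z s) w τ) * raisePoly (m s) s (∏ i, lowerForm z τ (t i) w) =
      ∑ i, C (∑ s, (m s : ℂ) * (sigma (x - z s) w τ * c i s)) * P1 i -
        ∑ i, ∑ j ∈ Finset.univ.erase i,
          linForm (fun s => sigma (x - z s) w τ * c i s * c j s) * P2 i j := by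
    simp only [lowerForm, raisePoly_prod, mul_sub, Finset.sum_sub_distrib]
    congr 1
    · simp only [Finset.mul_sum, map_sum, Finset.sum_mul]
      rw [Finset.sum_comm]
      refine Finset.sum_congr rfl fun i _ => Finset.sum_congr rfl fun s _ => ?_
      simp only [C_mul, hc, hP1, hℓ, lowerForm]
      ring
    · simp only [Finset.mul_sum]
      rw [Finset.sum_comm]
      refine Finset.sum_congr rfl fun i _ => ?_
      rw [Finset.sum_comm]
      refine Finset.sum_congr rfl fun j _ => ?_
      rw [linForm, Finset.sum_mul]
      refine Finset.sum_congr rfl fun s _ => ?_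
      simp only [C_mul, hc, hP2, hℓ, lowerForm]
      ring
  have e2 : ∑ i, ∑ j ∈ Finset.univ.erase i,
        linForm (fun s => sigma (x - z s) w τ * c i s * c j s) * P2 i j =
      ∑ i, ∑ j ∈ Finset.univ.erase i,
        C (S i * (rho (t i - t j) τ - rho (x - t j) τ) + dsigma (x - t i) w τ) * P1 i -
      ∑ i, ∑ j ∈ Finset.univ.erase i, C (S i * S2 i j) * P1 j +
      lowerForm z τ x w * ∑ i, ∑ j ∈ Finset.univ.erase i, C (S i) * C (S j) * P2 i j := by
    simp only [Finset.mul_sum, ← Finset.sum_sub_distrib, ← Finset.sum_add_distrib]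
    refine Finset.sum_congr rfl fun i _ => Finset.sum_congr rfl fun j hj => ?_
    have h1 : ℓ j * P2 i j = P1 i := Finset.mul_prod_erase _ _ hj
    have h2 : ℓ i * P2 i j = P1 j := by
      simp only [hP2, Finset.erase_right_comm (a := i)]
      exact Finset.mul_prod_erase _ _ (Finset.mem_erase.mpr ⟨hne hj, Finset.mem_univ i⟩)
    rw [hσcc i j (hne hj), ← h1, ← h2]
    simp only [C_mul]
    ring
  -- Exchanging the names of i and j attaches these terms to `P1 i`, so that coefficients can be
  -- compared for each i.
  have e3 : ∑ i, ∑ j ∈ Finset.univ.erase i, C (S i * S2 i j) * P1 j =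
      ∑ i, ∑ j ∈ Finset.univ.erase i, C (S j * S2 j i) * P1 i :=
    Finset.sum_comm' fun i j => by simp [eq_comm]
  rw [e1, e2, e3, sub_add_eq_sub_sub, ← Finset.sum_sub_distrib, ← Finset.sum_sub_distrib]
  congr 1
  refine Finset.sum_congr rfl fun i _ => ?_
  rw [← Finset.sum_sub_distrib]
  simp only [← sub_mul, ← Finset.sum_mul, ← C_sub, ← map_sum]
  congr 2
  have hcard : ((Finset.univ.erase i).card : ℂ) = M - 1 := by
    have h := Finset.card_erase_add_one (Finset.mem_univ i)
    rw [Finset.card_univ, Fintype.card_fin] at h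
    have h' : ((Finset.univ.erase i).card : ℂ) + 1 = M := by exact_mod_cast h
    linear_combination h'
  have hmC : ∑ s, (m s : ℂ) = 2 * M := by exact_mod_cast hm
  -- The `dsigma` terms occur 2M times here, because ∑ m_s = 2M, and 2(M − 1) times in `f2`; the
  -- difference is the coefficient 2 of the statement.
  have f1 : ∑ s, (m s : ℂ) * (sigma (x - z s) w τ * c i s) =
      S i * (∑ s, (m s : ℂ) * rho (t i - z s) τ - ∑ s, (m s : ℂ) * rho (x - z s) τ) +
        2 * M * dsigma (x - t i) w τ := by
    rw [← hmC, Finset.sum_mul, ← Finset.sum_sub_distrib, Finset.mul_sum,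
      ← Finset.sum_add_distrib]
    refine Finset.sum_congr rfl fun s _ => ?_
    rw [hσc]
    ring
  have f2 : ∑ j ∈ Finset.univ.erase i,
      ((S i * (rho (t i - t j) τ - rho (x - t j) τ) + dsigma (x - t i) w τ) - S j * S2 j i) =
      2 * S i * (∑ j ∈ Finset.univ.erase i, rho (t i - t j) τ -
        ∑ j ∈ Finset.univ.erase i, rho (x - t j) τ) + 2 * (M - 1) * dsigma (x - t i) w τ := by
    rw [← hcard, ← Finset.sum_sub_distrib, Finset.mul_sum]
    have : 2 * ((Finset.univ.erase i).card : ℂ) * dsigma (x - t i) w τ =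
        ∑ j ∈ Finset.univ.erase i, 2 * dsigma (x - t i) w τ := by
      rw [Finset.sum_const, nsmul_eq_mul]; ring
    rw [this, ← Finset.sum_add_distrib]
    refine Finset.sum_congr rfl fun j hj => ?_
    rw [hSS i j (hne hj)]
    ring
  have f3 : ∑ j ∈ Finset.univ.erase i, rho (x - t j) τ = ∑ j, rho (x - t j) τ - rho (x - t i) τ := by
    rw [← Finset.add_sum_erase _ _ (Finset.mem_univ i)]; ring
  rw [f1, f2, f3]
  -- The Bethe equation replaces all values of ρ at t_i − z_s and t_i − t_j by 2πiμ.
  linear_combination -S i * hB.equation i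

end Eigen

/-! ### The eigenvalue identity for the Bethe polynomial. -/

section Eigen

open MvPolynomial

variable {n M : ℕ}

/-- The polynomial that represents the Bethe eigenfunction. -/
def betheForm (μ : ℂ) (t : Fin M → ℂ) (z : Fin n → ℂ) (τ w : ℂ) : MvPolynomial (Fin n) ℂ :=
  C (Complex.exp (Real.pi * Complex.I * μ * w)) * ∏ i, lowerForm z τ (t i) w

/-- The twisted derivative of `betheForm`. -/
def betheForm₁ (μ : ℂ) (t : Fin M → ℂ) (z : Fin n → ℂ) (τ x w : ℂ) : MvPolynomial (Fin n) ℂ :=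
  C (Complex.exp (Real.pi * Complex.I * μ * w)) *
    (C (Real.pi * Complex.I * μ + ∑ i, rho (x - t i) τ) * ∏ i, lowerForm z τ (t i) w -
      lowerForm z τ x w * ∑ i, C (sigma (x - t i) w τ) *
        ∏ j ∈ Finset.univ.erase i, lowerForm z τ (t j) w)

/-- The twisted derivative of `betheForm₁`. -/
def betheForm₂ (μ : ℂ) (t : Fin M → ℂ) (z : Fin n → ℂ) (τ x w : ℂ) : MvPolynomial (Fin n) ℂ :=
  C (Complex.exp (Real.pi * Complex.I * μ * w)) *
    (C (Real.pi * Complex.I * μ + ∑ i, rho (x - t i) τ) ^ 2 * ∏ i, lowerForm z τ (t i) w +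
      (C (rho w τ) * lowerForm z τ x w -
        2 * C (Real.pi * Complex.I * μ + ∑ i, rho (x - t i) τ) * lowerForm z τ x w +
        lowerForm' z τ x w) *
        ∑ i, C (sigma (x - t i) w τ) * ∏ j ∈ Finset.univ.erase i, lowerForm z τ (t j) w +
      lowerForm z τ x w * ∑ i, C (sigma (x - t i) w τ * rho (x - t i) τ) *
        ∏ j ∈ Finset.univ.erase i, lowerForm z τ (t j) w -
      lowerForm z τ x w * ∑ i, C (dsigma (x - t i) w τ) *
        ∏ j ∈ Finset.univ.erase i, lowerForm z τ (t j) w +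
      lowerForm z τ x w ^ 2 * ∑ i, ∑ j ∈ Finset.univ.erase i,
          C (sigma (x - t i) w τ) * C (sigma (x - t j) w τ) *
            ∏ l ∈ (Finset.univ.erase i).erase j, lowerForm z τ (t l) w)

lemma hasTwistedDeriv_betheForm {τ : ℂ} (hτ : 0 < τ.im) {z : Fin n → ℂ} {x w : ℂ}
    (hx : ∀ s, x - z s ∉ lattice τ) (hw : w ∉ lattice τ) {t : Fin M → ℂ}
    (ht : ∀ i s, t i - z s ∉ lattice τ) (hxt : ∀ i, x - t i ∉ lattice τ) (μ : ℂ) :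
    HasTwistedDeriv (fun s => rho (x - z s) τ) (betheForm μ t z τ) (betheForm₁ μ t z τ x w) w := by
  refine (HasTwistedDeriv.exp_mul μ
    (hasTwistedDeriv_prod hτ hx hw ht hxt Finset.univ)).congr_deriv ?_
  rw [betheForm₁, C_add]
  ring

lemma hasTwistedDeriv_betheForm₁ {τ : ℂ} (hτ : 0 < τ.im) {z : Fin n → ℂ} {x w : ℂ}
    (hx : ∀ s, x - z s ∉ lattice τ) (hw : w ∉ lattice τ) {t : Fin M → ℂ}
    (ht : ∀ i s, t i - z s ∉ lattice τ) (hxt : ∀ i, x - t i ∉ lattice τ) (μ : ℂ) :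
    HasTwistedDeriv (fun s => rho (x - z s) τ) (betheForm₁ μ t z τ x)
      (betheForm₂ μ t z τ x w) w := by
  have h1 := fun i => (HasTwistedDeriv.const_C (g := fun s => rho (x - z s) τ)
    (hasDerivAt_sigma hτ (x - t i) hw)).mul
    (hasTwistedDeriv_prod hτ hx hw ht hxt (Finset.univ.erase i))
  have h2 := (hasTwistedDeriv_lowerForm_self hτ hx hw).mul
    (HasTwistedDeriv.sum (I := Finset.univ) fun i _ => h1 i)
  have h3 := (HasTwistedDeriv.const_C (g := fun s => rho (x - z s) τ)
    (hasDerivAt_const w (Real.pi * Complex.I * μ + ∑ i, rho (x - t i) τ))).mul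
    (hasTwistedDeriv_prod hτ hx hw ht hxt Finset.univ)
  refine ((h3.sub h2).exp_mul μ).congr_deriv ?_
  have f3 : ∀ i, ∑ j ∈ Finset.univ.erase i, rho (x - t j) τ =
      ∑ j, rho (x - t j) τ - rho (x - t i) τ := fun i => by
    rw [← Finset.add_sum_erase _ _ (Finset.mem_univ i)]; ring
  have e : ∑ i, (C (dsigma (x - t i) w τ) * ∏ j ∈ Finset.univ.erase i, lowerForm z τ (t j) w +
      C (sigma (x - t i) w τ) *
        (C (∑ j ∈ Finset.univ.erase i, rho (x - t j) τ) *
          ∏ j ∈ Finset.univ.erase i, lowerForm z τ (t j) w -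
        lowerForm z τ x w * ∑ j ∈ Finset.univ.erase i, C (sigma (x - t j) w τ) *
          ∏ l ∈ (Finset.univ.erase i).erase j, lowerForm z τ (t l) w)) =
      ∑ i, C (dsigma (x - t i) w τ) * ∏ j ∈ Finset.univ.erase i, lowerForm z τ (t j) w +
      C (∑ j, rho (x - t j) τ) * ∑ i, C (sigma (x - t i) w τ) *
          ∏ j ∈ Finset.univ.erase i, lowerForm z τ (t j) w -
      ∑ i, C (sigma (x - t i) w τ * rho (x - t i) τ) *
        ∏ j ∈ Finset.univ.erase i, lowerForm z τ (t j) w -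
      lowerForm z τ x w * ∑ i, ∑ j ∈ Finset.univ.erase i,
          C (sigma (x - t i) w τ) * C (sigma (x - t j) w τ) *
            ∏ l ∈ (Finset.univ.erase i).erase j, lowerForm z τ (t l) w := by
    rw [Finset.mul_sum, Finset.mul_sum, ← Finset.sum_add_distrib, ← Finset.sum_sub_distrib,
      ← Finset.sum_sub_distrib]
    refine Finset.sum_congr rfl fun i _ => ?_
    simp only [mul_assoc (C (sigma (x - t i) w τ)) (C (sigma _ w τ)), ← Finset.mul_sum]
    rw [f3, C_sub, C_mul]
    ring
  rw [e, betheForm₂]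
  simp only [C_0, C_add]
  ring

/-- The first three terms are (D − a)² − a' on the Bethe polynomial. Its ℓ_x² double sum cancels
against that of e^+_12(x), its ℓ_x' sum against that of `sum_drho_mul_pderiv`, and the single sums
with ℓ_x cancel by `dsigma_sub_dsigma` (`hT`). -/
theorem betheForm_eigen {τ : ℂ} (hτ : 0 < τ.im) {z : Fin n → ℂ} {x w : ℂ}
    (hx : ∀ s, x - z s ∉ lattice τ) (hw : w ∉ lattice τ) {t : Fin M → ℂ}
    (hxt : ∀ i, x - t i ∉ lattice τ) {m : Fin n → ℕ} (hm : ∑ s, m s = 2 * M) {μ : ℂ}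
    (hB : IsBetheSolution m μ t z τ) {a a' : ℂ} (ha : a = 1 / 2 * ∑ s, (m s : ℂ) * rho (x - z s) τ) :
    betheForm₂ μ t z τ x w - C (2 * a) * betheForm₁ μ t z τ x w +
      C (a ^ 2 - a') * betheForm μ t z τ w +
      ∑ s, C (drho (x - z s) τ) * (X s * pderiv s (betheForm μ t z τ w)) +
      lowerForm z τ x w *
        ∑ s, C (sigma (x - z s) w τ) * raisePoly (m s) s (betheForm μ t z τ w) =
    C ((Real.pi * Complex.I * μ + ∑ i, rho (x - t i) τ - a) ^ 2 +
      (∑ i, drho (x - t i) τ - a')) * betheForm μ t z τ w := by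
  have hE := sum_sigma_mul_raisePoly hτ hx hw hB.t_sub_z hxt hm hB
  have hN := sum_drho_mul_pderiv hτ hx hw hB.t_sub_z hxt
  rw [← ha] at hE
  have hT : ∑ i, C (dsigma (x - t i) w τ) * ∏ j ∈ Finset.univ.erase i, lowerForm z τ (t j) w -
      ∑ i, C (dsigma w (x - t i) τ) * ∏ j ∈ Finset.univ.erase i, lowerForm z τ (t j) w =
      ∑ i, C (sigma (x - t i) w τ * rho (x - t i) τ) *
        ∏ j ∈ Finset.univ.erase i, lowerForm z τ (t j) w -
      C (rho w τ) * ∑ i, C (sigma (x - t i) w τ) *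
        ∏ j ∈ Finset.univ.erase i, lowerForm z τ (t j) w := by
    rw [Finset.mul_sum, ← Finset.sum_sub_distrib, ← Finset.sum_sub_distrib]
    refine Finset.sum_congr rfl fun i _ => ?_
    rw [← sub_mul, ← C_sub, dsigma_sub_dsigma hτ (hxt i) hw]
    simp only [C_mul, C_sub]
    ring
  have hE' : ∑ i, C (2 * (sigma (x - t i) w τ * (Real.pi * Complex.I * μ + ∑ j, rho (x - t j) τ -
          a - rho (x - t i) τ) +
          dsigma (x - t i) w τ)) * ∏ j ∈ Finset.univ.erase i, lowerForm z τ (t j) w =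
      2 * (C (Real.pi * Complex.I * μ + ∑ j, rho (x - t j) τ - a) *
        ∑ i, C (sigma (x - t i) w τ) * ∏ j ∈ Finset.univ.erase i, lowerForm z τ (t j) w -
      ∑ i, C (sigma (x - t i) w τ * rho (x - t i) τ) *
        ∏ j ∈ Finset.univ.erase i, lowerForm z τ (t j) w +
      ∑ i, C (dsigma (x - t i) w τ) * ∏ j ∈ Finset.univ.erase i, lowerForm z τ (t j) w) := by
    rw [Finset.mul_sum, ← Finset.sum_sub_distrib, ← Finset.sum_add_distrib, Finset.mul_sum]
    refine Finset.sum_congr rfl fun i _ => ?_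
    generalize Real.pi * Complex.I * μ + ∑ j, rho (x - t j) τ - a = U
    simp only [C_mul, C_sub, C_add, map_ofNat]
    ring
  rw [hE'] at hE
  simp only [betheForm, betheForm₁, betheForm₂, pderiv_C_mul, raisePoly_C_mul]
  have g1 : ∀ e : MvPolynomial (Fin n) ℂ, ∑ s, C (drho (x - z s) τ) *
      (X s * (e * pderiv s (∏ i, lowerForm z τ (t i) w))) =
      e * ∑ s, C (drho (x - z s) τ) * (X s * pderiv s (∏ i, lowerForm z τ (t i) w)) := fun e => by
    rw [Finset.mul_sum]
    exact Finset.sum_congr rfl fun s _ => by ring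
  have g2 : ∀ e : MvPolynomial (Fin n) ℂ, ∑ s, C (sigma (x - z s) w τ) *
      (e * raisePoly (m s) s (∏ i, lowerForm z τ (t i) w)) =
      e * ∑ s, C (sigma (x - z s) w τ) * raisePoly (m s) s (∏ i, lowerForm z τ (t i) w) :=
    fun e => by
      rw [Finset.mul_sum]
      exact Finset.sum_congr rfl fun s _ => by ring
  rw [g1, g2, hE, hN]
  simp only [C_mul, C_sub, C_add, C_pow, map_ofNat]
  simp only [C_mul] at hT
  linear_combination (C (Complex.exp (Real.pi * Complex.I * μ * w)) * lowerForm z τ x w) * hT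

end Eigen

/-! ### The operator `S₂` in coordinates -/

section Operator

variable {n : ℕ} {m : Fin n → ℕ}

lemma eTotal_zero_zero_apply (v : TensorSpace m) (k : (s : Fin n) → Fin (m s + 1)) :
    eTotal m 0 0 v k = (∑ s, ((m s : ℂ) - 2 * (k s : ℕ)) / 2) * v k := by
  simp [eTotal, LinearMap.sum_apply, Finset.sum_apply, eSite_zero_zero_apply, Finset.sum_mul]

lemma eTotal_one_one_apply (v : TensorSpace m) (k : (s : Fin n) → Fin (m s + 1)) :
    eTotal m 1 1 v k = -((∑ s, ((m s : ℂ) - 2 * (k s : ℕ)) / 2) * v k) := by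
  simp [eTotal, LinearMap.sum_apply, Finset.sum_apply, eSite_one_one_apply, Finset.sum_mul]

lemma mem_zeroWeight_iff {v : TensorSpace m} :
    v ∈ zeroWeight m ↔
      ∀ k : (s : Fin n) → Fin (m s + 1), (∑ s, ((m s : ℂ) - 2 * (k s : ℕ)) / 2) * v k = 0 := by
  simp only [zeroWeight, Submodule.mem_iInf, Fin.forall_fin_two, LinearMap.mem_ker, funext_iff,
    eTotal_zero_zero_apply, eTotal_one_one_apply, Pi.zero_apply, neg_eq_zero, and_self]

lemma eTotal_apply_eq_zero {v : TensorSpace m} (hv : v ∈ zeroWeight m) (j : Fin 2) :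
    eTotal m j j v = 0 := by
  rw [zeroWeight, Submodule.mem_iInf] at hv
  exact hv j

/-- The eigenvalues of `∑_s ρ(x - z_s) e_{11}^{(s)}`. -/
def cartanCoeff (m : Fin n → ℕ) (z : Fin n → ℂ) (τ : ℂ) (k : (s : Fin n) → Fin (m s + 1))
    (x : ℂ) : ℂ := ∑ s, rho (x - z s) τ * (((m s : ℂ) - 2 * (k s : ℕ)) / 2)

lemma lax_zero_zero_apply (z : Fin n → ℂ) (τ x : ℂ) (lam : Fin 2 → ℂ) {v : TensorSpace m}
    (hv : v ∈ zeroWeight m) (k : (s : Fin n) → Fin (m s + 1)) :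
    lax m z τ 0 0 x lam v k = cartanCoeff m z τ k x * v k := by
  simp only [lax, ePlus, if_true, LinearMap.add_apply, LinearMap.sum_apply, LinearMap.smul_apply,
    eTotal_apply_eq_zero hv, smul_zero, Finset.sum_const_zero, add_zero, Finset.sum_apply,
    Pi.smul_apply, eSite_zero_zero_apply, smul_eq_mul, cartanCoeff, Finset.sum_mul, mul_assoc]

lemma lax_one_one_apply (z : Fin n → ℂ) (τ x : ℂ) (lam : Fin 2 → ℂ) {v : TensorSpace m}
    (hv : v ∈ zeroWeight m) (k : (s : Fin n) → Fin (m s + 1)) :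
    lax m z τ 1 1 x lam v k = -(cartanCoeff m z τ k x * v k) := by
  simp only [lax, ePlus, if_true, LinearMap.add_apply, LinearMap.sum_apply, LinearMap.smul_apply,
    eTotal_apply_eq_zero hv, smul_zero, Finset.sum_const_zero, add_zero, Finset.sum_apply,
    Pi.smul_apply, eSite_one_one_apply, smul_eq_mul, cartanCoeff, Finset.sum_mul, mul_assoc,
    mul_neg, Finset.sum_neg_distrib]

lemma rstOp_eq (z : Fin n → ℂ) (τ : ℂ) (F : ℂ → (Fin 2 → ℂ) → TensorSpace m) (x : ℂ)
    (lam : Fin 2 → ℂ) :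
    rstOp m z τ F x lam = rstEntry m z τ 0 0 (rstEntry m z τ 1 1 F) x lam -
      rstEntry m z τ 1 0 (rstEntry m z τ 0 1 F) x lam := by
  have h : (Finset.univ : Finset (Equiv.Perm (Fin 2))) = {1, Equiv.swap 0 1} := by decide
  have hne : (1 : Equiv.Perm (Fin 2)) ∉ ({Equiv.swap 0 1} : Finset (Equiv.Perm (Fin 2))) := by
    decide
  rw [rstOp, h, Finset.sum_insert hne, Finset.sum_singleton,
    Equiv.Perm.sign_swap (by decide : (0 : Fin 2) ≠ 1)]
  simp [sub_eq_add_neg]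

lemma differentiableAt_cartanCoeff {z : Fin n → ℂ} {τ x : ℂ} (hτ : 0 < τ.im)
    (hx : ∀ s, x - z s ∉ lattice τ) (k : (s : Fin n) → Fin (m s + 1)) :
    DifferentiableAt ℂ (cartanCoeff m z τ k) x := by
  unfold cartanCoeff
  refine DifferentiableAt.fun_sum fun s _ => DifferentiableAt.mul_const ?_ _
  exact ((HasDerivAt.comp_sub_const x (z s) (hasDerivAt_rho hτ (hx s)))).differentiableAt

lemma deriv_cartanCoeff {z : Fin n → ℂ} {τ x : ℂ} (hτ : 0 < τ.im)
    (hx : ∀ s, x - z s ∉ lattice τ) (k : (s : Fin n) → Fin (m s + 1)) :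
    deriv (cartanCoeff m z τ k) x =
      ∑ s, drho (x - z s) τ * (((m s : ℂ) - 2 * (k s : ℕ)) / 2) := by
  refine HasDerivAt.deriv ?_
  unfold cartanCoeff
  exact HasDerivAt.fun_sum fun s _ =>
    (HasDerivAt.comp_sub_const x (z s) (hasDerivAt_rho hτ (hx s))).mul_const _

lemma deriv_mem_zeroWeight {g : ℂ → TensorSpace m} (hg0 : ∀ w, g w ∈ zeroWeight m) {w : ℂ}
    (hg : DifferentiableAt ℂ g w) : deriv g w ∈ zeroWeight m := by
  rw [mem_zeroWeight_iff]
  intro k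
  have h1 := (hasDerivAt_pi.mp hg.hasDerivAt k).const_mul (∑ s, ((m s : ℂ) - 2 * (k s : ℕ)) / 2)
  have h2 : (fun w => (∑ s, ((m s : ℂ) - 2 * (k s : ℕ)) / 2) * g w k) = fun _ => 0 :=
    funext fun w => mem_zeroWeight_iff.mp (hg0 w) k
  rw [h2] at h1
  exact h1.unique (hasDerivAt_const w 0)

lemma rstEntry_one_one_apply {z : Fin n → ℂ} {τ : ℂ} {g : ℂ → TensorSpace m}
    (hg0 : ∀ w, g w ∈ zeroWeight m) (y : ℂ) {lam : Fin 2 → ℂ}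
    (hg : DifferentiableAt ℂ g (lam 0 - lam 1)) (k : (s : Fin n) → Fin (m s + 1)) :
    rstEntry m z τ 1 1 (fun _ lam => g (lam 0 - lam 1)) y lam k =
      deriv g (lam 0 - lam 1) k - cartanCoeff m z τ k y * g (lam 0 - lam 1) k := by
  have h : HasDerivAt (fun w => g (lam 0 - w)) (-deriv g (lam 0 - lam 1)) (lam 1) := by
    exact HasDerivAt.comp_const_sub (lam 0) (lam 1) hg.hasDerivAt
  simp only [rstEntry, if_true, deriv_const, Function.update_self, ne_eq, zero_ne_one,
    not_false_eq_true, Function.update_of_ne, h.deriv, zero_sub, neg_neg, Pi.add_apply,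
    lax_one_one_apply z τ y lam (hg0 _)]
  ring

/-- On zero weight functions of w = λ₁₂ the diagonal entries are ∂_x − ∂_w + h and ∂_x + ∂_w − h.
The derivative ∂_x in the left entry differentiates the coefficient h of the right one, hence the
term with h'. -/
lemma S2_apply {z : Fin n → ℂ} {τ : ℂ} (hτ : 0 < τ.im) {g : ℂ → TensorSpace m}
    (hg0 : ∀ w, g w ∈ zeroWeight m) (hg : DifferentiableOn ℂ g (lattice τ)ᶜ) {x : ℂ}
    (hx : ∀ s, x - z s ∉ lattice τ) {lam : Fin 2 → ℂ} (hl : lam 0 - lam 1 ∉ lattice τ)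
    (k : (s : Fin n) → Fin (m s + 1)) :
    S2 m z τ x (fun lam => g (lam 0 - lam 1)) lam k =
      -deriv (deriv g) (lam 0 - lam 1) k +
        2 * cartanCoeff m z τ k x * deriv g (lam 0 - lam 1) k -
        (cartanCoeff m z τ k x ^ 2 + deriv (cartanCoeff m z τ k) x) * g (lam 0 - lam 1) k -
        ePlus m z τ 0 1 x lam (ePlus m z τ 1 0 x lam (g (lam 0 - lam 1))) k := by
  have hopen : IsOpen (lattice τ)ᶜ := (isClosed_lattice hτ).isOpen_compl
  have hd : ∀ w ∉ lattice τ, DifferentiableAt ℂ g w := fun w hw =>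
    hg.differentiableAt (hopen.mem_nhds hw)
  have hd2 : DifferentiableAt ℂ (deriv g) (lam 0 - lam 1) :=
    (hg.deriv hopen).differentiableAt (hopen.mem_nhds hl)
  set G := rstEntry m z τ 1 1 (fun _ lam => g (lam 0 - lam 1)) with hG
  have hGk : ∀ y (lam : Fin 2 → ℂ), lam 0 - lam 1 ∉ lattice τ →
      ∀ k, G y lam k = deriv g (lam 0 - lam 1) k - cartanCoeff m z τ k y * g (lam 0 - lam 1) k :=
    fun y lam h k => rstEntry_one_one_apply hg0 y (hd _ h) k
  have hGx : HasDerivAt (fun y => G y lam)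
      (fun k => -(deriv (cartanCoeff m z τ k) x * g (lam 0 - lam 1) k)) x := by
    rw [hasDerivAt_pi]
    intro k
    simp only [hGk _ lam hl]
    exact ((differentiableAt_cartanCoeff hτ hx k).hasDerivAt.mul_const _).const_sub _
  have hGl : HasDerivAt (fun w => G x (Function.update lam 0 w))
      (fun k => deriv (deriv g) (lam 0 - lam 1) k -
        cartanCoeff m z τ k x * deriv g (lam 0 - lam 1) k) (lam 0) := by
    rw [hasDerivAt_pi]
    intro k
    have e : ∀ᶠ w in 𝓝 (lam 0), w - lam 1 ∉ lattice τ :=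
      (continuous_id.sub continuous_const).continuousAt.eventually
        (eventually_notMem_lattice hτ hl)
    have h1 := hasDerivAt_pi.mp (HasDerivAt.comp_sub_const (lam 0) (lam 1) hd2.hasDerivAt) k
    have h2 := hasDerivAt_pi.mp (HasDerivAt.comp_sub_const (lam 0) (lam 1) (hd _ hl).hasDerivAt) k
    refine (h1.sub (h2.const_mul (cartanCoeff m z τ k x))).congr_of_eventuallyEq ?_
    filter_upwards [e] with w hw
    rw [hGk x _ (by simpa using hw)]
    simp
  -- The intermediate function must have zero weight again for the terms ρ(λ_jl) e_ll of the left
  -- entry to vanish.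
  have hGw : G x lam ∈ zeroWeight m := by
    rw [mem_zeroWeight_iff]
    intro k
    rw [hGk x lam hl]
    have h1 := mem_zeroWeight_iff.mp (deriv_mem_zeroWeight hg0 (hd _ hl)) k
    have h2 := mem_zeroWeight_iff.mp (hg0 (lam 0 - lam 1)) k
    linear_combination h1 - cartanCoeff m z τ k x * h2
  rw [S2, rstOp_eq, ← hG]
  have e1 : rstEntry m z τ 0 0 G x lam k =
      -(deriv (cartanCoeff m z τ k) x * g (lam 0 - lam 1) k) -
        (deriv (deriv g) (lam 0 - lam 1) k -
        cartanCoeff m z τ k x * deriv g (lam 0 - lam 1) k) + cartanCoeff m z τ k x * G x lam k := by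
    simp only [rstEntry, if_true, hGx.deriv, hGl.deriv, Pi.add_apply, Pi.sub_apply,
      lax_zero_zero_apply z τ x lam hGw]
  have e2 : rstEntry m z τ 1 0 (rstEntry m z τ 0 1 fun _ lam => g (lam 0 - lam 1)) x lam =
      ePlus m z τ 0 1 x lam (ePlus m z τ 1 0 x lam (g (lam 0 - lam 1))) := by
    simp [rstEntry, lax]
  rw [Pi.sub_apply, e1, e2, hGk x lam hl]
  ring

lemma ePlus_zero_one_proj (z : Fin n → ℂ) (τ x : ℂ) (lam : Fin 2 → ℂ)
    (p : MvPolynomial (Fin n) ℂ) :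
    ePlus m z τ 0 1 x lam (proj m p) =
      proj m (∑ s, MvPolynomial.C (sigma (x - z s) (lam 0 - lam 1) τ) * raisePoly (m s) s p) := by
  funext k
  simp [ePlus, LinearMap.sum_apply, eSite_zero_one_proj, proj, MvPolynomial.coeff_sum,
    MvPolynomial.coeff_C_mul, Finset.sum_apply]

lemma ePlus_one_zero_proj (z : Fin n → ℂ) (τ x : ℂ) (lam : Fin 2 → ℂ)
    (p : MvPolynomial (Fin n) ℂ) :
    ePlus m z τ 1 0 x lam (proj m p) = proj m (lowerForm z τ x (lam 0 - lam 1) * p) := by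
  funext k
  simp [ePlus, LinearMap.sum_apply, eSite_one_zero_proj, proj, MvPolynomial.coeff_sum,
    MvPolynomial.coeff_C_mul, Finset.sum_apply, lowerForm, linForm, lowerCoeff, Finset.sum_mul,
    mul_assoc]

lemma ePlus_ePlus_apply (z : Fin n → ℂ) (τ x : ℂ) (lam : Fin 2 → ℂ) (v : TensorSpace m)
    (k : (s : Fin n) → Fin (m s + 1)) :
    ePlus m z τ 0 1 x lam (ePlus m z τ 1 0 x lam v) k =
      ∑ s, ∑ p, sigma (x - z s) (lam 0 - lam 1) τ * (sigma (x - z p) (lam 1 - lam 0) τ *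
        eSite m 0 1 s (eSite m 1 0 p v) k) := by
  simp only [ePlus, zero_ne_one, one_ne_zero, if_false, LinearMap.sum_apply, LinearMap.smul_apply,
    map_sum, map_smul, Finset.sum_apply, Pi.smul_apply, smul_eq_mul, Finset.mul_sum]
  rw [Finset.sum_comm]
  exact Finset.sum_congr rfl fun s _ => Finset.sum_congr rfl fun p _ => by ring

end Operator

/-! ### The Bethe eigenfunction -/

section BetheFunction

variable {n M : ℕ} {m : Fin n → ℕ}

/-- The Bethe eigenfunction as a function of `λ₁₂`. -/
def betheVector (m : Fin n → ℕ) (μ : ℂ) (t : Fin M → ℂ) (z : Fin n → ℂ) (τ w : ℂ) :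
    TensorSpace m := proj m (betheForm μ t z τ w)

/-- The maps that take each value `s` exactly `k_s` times. -/
def fiberMaps (M : ℕ) (k : (s : Fin n) → Fin (m s + 1)) : Finset (Fin M → Fin n) :=
  Finset.univ.filter fun c => ∀ s, (Finset.univ.filter (fun i => c i = s)).card = (k s : ℕ)

/-- Expanding the product of linear forms chooses one variable X_{c(i)} per factor, and the
resulting monomial is X^k exactly when c has fibres of sizes k_s. -/
lemma betheVector_apply (μ : ℂ) (t : Fin M → ℂ) (z : Fin n → ℂ) (τ w : ℂ)
    (k : (s : Fin n) → Fin (m s + 1)) :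
    betheVector m μ t z τ w k = Complex.exp (Real.pi * Complex.I * μ * w) *
      ∑ c ∈ fiberMaps M k, ∏ i, sigma (t i - z (c i)) (-w) τ := by
  classical
  simp only [betheVector, proj, betheForm, MvPolynomial.coeff_C_mul, lowerForm, linForm]
  congr 1
  rw [Finset.prod_univ_sum, MvPolynomial.coeff_sum, fiberMaps, Finset.sum_filter,
    Fintype.piFinset_univ]
  refine Finset.sum_congr rfl fun c _ => ?_
  rw [Finset.prod_mul_distrib, ← map_prod, MvPolynomial.coeff_C_mul]
  have h : ∏ i, (MvPolynomial.X (c i) : MvPolynomial (Fin n) ℂ) =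
      MvPolynomial.monomial (∑ i, Finsupp.single (c i) 1) 1 := by
    simp only [MvPolynomial.X, MvPolynomial.monomial_sum_one]
  have h2 : ∀ s, (∑ i, Finsupp.single (c i) 1 : Fin n →₀ ℕ) s =
      (Finset.univ.filter (fun i => c i = s)).card := fun s => by
    rw [Finsupp.finsetSum_apply, Finset.card_filter]
    exact Finset.sum_congr rfl fun i _ => Finsupp.single_apply
  have h3 : (∑ i, Finsupp.single (c i) 1 : Fin n →₀ ℕ) = exponent k ↔
      ∀ s, (Finset.univ.filter (fun i => c i = s)).card = (k s : ℕ) := by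
    rw [Finsupp.ext_iff]
    exact forall_congr' fun s => by rw [h2, exponent_apply]
  rw [h, MvPolynomial.coeff_monomial]
  simp only [h3, mul_ite, mul_one, mul_zero, lowerCoeff]

lemma betheFunction_eq (μ : ℂ) (t : Fin M → ℂ) (z : Fin n → ℂ) (τ : ℂ) :
    betheFunction m μ t z τ = fun lam => betheVector m μ t z τ (lam 0 - lam 1) := by
  funext lam k
  rw [betheVector_apply]
  rfl

lemma sum_eq_of_mem_fiberMaps {k : (s : Fin n) → Fin (m s + 1)} {c : Fin M → Fin n}
    (hc : c ∈ fiberMaps M k) : ∑ s, (k s : ℕ) = M := by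
  have h := Finset.card_eq_sum_card_fiberwise (f := c) (s := Finset.univ) (t := Finset.univ)
    (fun _ _ => Finset.mem_coe.mpr (Finset.mem_univ _))
  rw [Finset.card_univ, Fintype.card_fin] at h
  rw [fiberMaps, Finset.mem_filter] at hc
  rw [h]
  exact Finset.sum_congr rfl fun s _ => (hc.2 s).symm

/-- A coordinate can be nonzero only if ∑ k_s = M, and then ∑ (m_s − 2k_s) = 2M − 2M. -/
lemma betheVector_mem_zeroWeight (hm : ∑ s, m s = 2 * M) (μ : ℂ) (t : Fin M → ℂ) (z : Fin n → ℂ)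
    (τ w : ℂ) : betheVector m μ t z τ w ∈ zeroWeight m := by
  rw [mem_zeroWeight_iff]
  intro k
  by_cases h : (fiberMaps M k).Nonempty
  · obtain ⟨c, hc⟩ := h
    have hk : ∑ s, ((k s : ℕ) : ℂ) = M := by exact_mod_cast sum_eq_of_mem_fiberMaps hc
    have hmC : ∑ s, (m s : ℂ) = 2 * M := by exact_mod_cast hm
    rw [← Finset.sum_div, Finset.sum_sub_distrib, ← Finset.mul_sum, hk, hmC]
    simp
  · rw [betheVector_apply, Finset.not_nonempty_iff_eq_empty.mp h]
    simp

lemma differentiableOn_betheVector {τ : ℂ} (hτ : 0 < τ.im) (μ : ℂ) (t : Fin M → ℂ)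
    (z : Fin n → ℂ) : DifferentiableOn ℂ (betheVector m μ t z τ) (lattice τ)ᶜ := by
  rw [differentiableOn_pi]
  intro k
  simp only [betheVector_apply]
  refine DifferentiableOn.mul (by fun_prop) (DifferentiableOn.fun_sum fun c _ =>
    DifferentiableOn.fun_finsetProd fun i _ w hw => ?_)
  exact (hasDerivAt_sigma_neg hτ _ hw).differentiableAt.differentiableWithinAt

lemma meromorphic_betheVector {τ : ℂ} (hτ : 0 < τ.im) (μ : ℂ) (t : Fin M → ℂ)
    (z : Fin n → ℂ) : Meromorphic (betheVector m μ t z τ) := by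
  classical
  have e : betheVector m μ t z τ = ∑ k, fun w =>
      betheVector m μ t z τ w k • (Pi.single k 1 : TensorSpace m) := by
    funext w
    rw [Finset.sum_apply]
    exact pi_eq_sum_univ' _
  rw [e]
  intro w
  refine MeromorphicAt.sum fun k _ => MeromorphicAt.fun_smul ?_ (MeromorphicAt.const _ _)
  simp only [betheVector_apply]
  have hθ := differentiable_theta hτ
  have hmer : ∀ f : ℂ → ℂ, Differentiable ℂ f → MeromorphicAt f w := fun f hf =>
    (hf.analyticAt w).meromorphicAt
  refine MeromorphicAt.mul (hmer _ (by fun_prop)) (MeromorphicAt.fun_sum fun c _ =>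
    MeromorphicAt.fun_prod fun i _ => ?_)
  unfold sigma
  refine MeromorphicAt.div (hmer _ ?_) (hmer _ ?_)
  · exact hθ.comp (g := fun y => theta y τ) (f := fun w => t i - z (c i) + -w) (by fun_prop)
  · exact (hθ.comp (g := fun y => theta y τ) (f := fun w => -w) (by fun_prop)).const_mul _

lemma isFun_betheFunction {τ : ℂ} (hτ : 0 < τ.im) (hm : ∑ s, m s = 2 * M) (μ : ℂ)
    (t : Fin M → ℂ) (z : Fin n → ℂ) : IsFun m (betheFunction m μ t z τ) :=
  ⟨betheVector m μ t z τ, meromorphic_betheVector hτ μ t z,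
    betheVector_mem_zeroWeight hm μ t z τ, fun lam => by rw [betheFunction_eq]⟩

lemma tendsto_mul_sigma {τ : ℂ} (hτ : 0 < τ.im) {u : ℂ} (hu : u ∉ lattice τ) :
    Tendsto (fun w => w * sigma u (-w) τ) (𝓝[≠] 0) (𝓝 (-1)) := by
  have hu0 : theta u τ ≠ 0 := fun h => hu ((theta_eq_zero_iff hτ).mp h)
  have h1 : Tendsto (fun w => w⁻¹ * theta w τ) (𝓝[≠] 0) (𝓝 1) := by
    have := hasDerivAt_iff_tendsto_slope_zero.mp (hasDerivAt_theta_zero hτ)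
    simpa [theta_zero] using this
  have h2 : Tendsto (fun w => theta (u + -w) τ) (𝓝[≠] 0) (𝓝 (theta u τ)) := by
    have : Continuous fun w => theta (u + -w) τ :=
      (differentiable_theta hτ).continuous.comp (by fun_prop)
    have := this.tendsto 0
    rw [neg_zero, add_zero] at this
    exact this.mono_left nhdsWithin_le_nhds
  have h3 := ((h2.div_const (theta u τ)).mul (h1.inv₀ one_ne_zero)).neg
  rw [div_self hu0, inv_one, one_mul] at h3
  refine h3.congr fun w => ?_
  rw [sigma, theta_neg, mul_inv, inv_inv, mul_neg, div_neg, ← div_div]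
  ring

/-- Since M ≤ 2M = ∑ m_s, M points can be distributed over boxes of capacities m_s. -/
lemma exists_fiberMaps_nonempty (hm : ∑ s, m s = 2 * M) :
    ∃ k : (s : Fin n) → Fin (m s + 1), (fiberMaps M k).Nonempty := by
  have hcard : Fintype.card (Fin M) ≤ Fintype.card ((s : Fin n) × Fin (m s)) := by
    simp [hm]; omega
  obtain ⟨f⟩ := Function.Embedding.nonempty_of_card_le hcard
  have hle : ∀ s, (Finset.univ.filter (fun i => (f i).1 = s)).card ≤ m s := fun s => by
    have hsub : (Finset.univ.filter (fun i => (f i).1 = s)).map f ⊆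
        (Finset.univ : Finset (Fin (m s))).map (Function.Embedding.sigmaMk s) := by
      intro a ha
      obtain ⟨i, hi, rfl⟩ := Finset.mem_map.mp ha
      obtain rfl := (Finset.mem_filter.mp hi).2
      exact Finset.mem_map.mpr ⟨(f i).2, Finset.mem_univ _, rfl⟩
    have h := Finset.card_le_card hsub
    rw [Finset.card_map, Finset.card_map] at h
    simpa using h
  exact ⟨fun s => ⟨_, Nat.lt_succ_of_le (hle s)⟩, fun i => (f i).1, by simp [fiberMaps]⟩

/-- As w → 0 each wσ(u, −w) tends to −1, so w^M W_k tends to (−1)^M times the number of maps c: the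
leading terms all have the same sign and cannot cancel. -/
lemma exists_betheVector_ne_zero {τ : ℂ} (hτ : 0 < τ.im) (hm : ∑ s, m s = 2 * M) (μ : ℂ)
    {t : Fin M → ℂ} {z : Fin n → ℂ} (ht : ∀ i s, t i - z s ∉ lattice τ) :
    ∃ w ∉ lattice τ, ∃ k, betheVector m μ t z τ w k ≠ 0 := by
  obtain ⟨k, hk⟩ := exists_fiberMaps_nonempty hm
  have h1 : Tendsto (fun w => ∑ c ∈ fiberMaps M k, ∏ i, (w * sigma (t i - z (c i)) (-w) τ))
      (𝓝[≠] 0) (𝓝 (∑ c ∈ fiberMaps M k, ∏ _i : Fin M, (-1))) :=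
    tendsto_finsetSum _ fun c _ => tendsto_finsetProd _ fun i _ => tendsto_mul_sigma hτ (ht i _)
  have h2 : ∑ c ∈ fiberMaps M k, ∏ _i : Fin M, (-1 : ℂ) ≠ 0 := by
    simp [hk.card_pos.ne']
  have h3 := h1.eventually_ne h2
  have h4 : ∀ᶠ w in 𝓝[≠] (0 : ℂ), w ∉ lattice τ := by
    have hd : HasDerivAt (fun x => theta x τ) 1 0 := hasDerivAt_theta_zero hτ
    filter_upwards [hd.eventually_ne one_ne_zero (c := 0)] with w hw
    rwa [← theta_eq_zero_iff hτ]
  obtain ⟨w, hw, hwl⟩ := (h3.and h4).exists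
  refine ⟨w, hwl, k, ?_⟩
  rw [betheVector_apply]
  refine mul_ne_zero (Complex.exp_ne_zero _) fun h => hw ?_
  simp only [Finset.prod_mul_distrib, Finset.prod_const, ← Finset.mul_sum]
  rw [h, mul_zero]

end BetheFunction

/-! ### The eigenvalue -/

section Eigenvalue

variable {n M : ℕ} {m : Fin n → ℕ}

/-- The logarithmic derivative of
`e^{πiμx} ∏_i θ(x - t_i) ∏_s θ(x - z_s)^{-m_s/2}`. -/
def betheLogDeriv (m : Fin n → ℕ) (μ : ℂ) (t : Fin M → ℂ) (z : Fin n → ℂ) (τ x : ℂ) : ℂ :=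
  Real.pi * Complex.I * μ + ∑ i, rho (x - t i) τ - 1 / 2 * ∑ s, (m s : ℂ) * rho (x - z s) τ

lemma hasDerivAt_betheLogDeriv {τ : ℂ} (hτ : 0 < τ.im) {z : Fin n → ℂ} {x : ℂ}
    (hx : ∀ s, x - z s ∉ lattice τ) {t : Fin M → ℂ} (hxt : ∀ i, x - t i ∉ lattice τ) (μ : ℂ) :
    HasDerivAt (betheLogDeriv m μ t z τ)
      (∑ i, drho (x - t i) τ - 1 / 2 * ∑ s, (m s : ℂ) * drho (x - z s) τ) x := by
  have h1 := HasDerivAt.fun_sum (u := Finset.univ) fun i _ =>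
    HasDerivAt.comp_sub_const x (t i) (hasDerivAt_rho hτ (hxt i))
  have h2 := HasDerivAt.fun_sum (u := Finset.univ) fun s _ =>
    (HasDerivAt.comp_sub_const x (z s) (hasDerivAt_rho hτ (hx s))).const_mul (m s : ℂ)
  exact (h1.const_add (Real.pi * Complex.I * μ)).sub (h2.const_mul (1 / 2))

/-- The coefficient of X^k in `betheForm_eigen`, once the w-derivatives in `S2_apply` are rewritten
as twisted derivatives. -/
lemma S2_betheVector_of_notMem {τ : ℂ} (hτ : 0 < τ.im) (hm : ∑ s, m s = 2 * M) {z : Fin n → ℂ}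
    {x : ℂ} (hx : ∀ s, x - z s ∉ lattice τ) {t : Fin M → ℂ} (hxt : ∀ i, x - t i ∉ lattice τ)
    {μ : ℂ} (hB : IsBetheSolution m μ t z τ) {lam : Fin 2 → ℂ}
    (hl : lam 0 - lam 1 ∉ lattice τ) (k : (s : Fin n) → Fin (m s + 1)) :
    S2 m z τ x (fun lam => betheVector m μ t z τ (lam 0 - lam 1)) lam k =
      (-deriv (betheLogDeriv m μ t z τ) x - betheLogDeriv m μ t z τ x ^ 2) *
        betheVector m μ t z τ (lam 0 - lam 1) k := by
  have hopen : IsOpen (lattice τ)ᶜ := (isClosed_lattice hτ).isOpen_compl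
  have hdiff := differentiableOn_betheVector (m := m) hτ μ t z
  have hzero := betheVector_mem_zeroWeight hm μ t z τ
  rw [S2_apply hτ hzero hdiff hx hl, (hasDerivAt_betheLogDeriv hτ hx hxt μ).deriv,
    deriv_cartanCoeff hτ hx]
  set w := lam 0 - lam 1 with hwdef
  set a : ℂ := 1 / 2 * ∑ s, (m s : ℂ) * rho (x - z s) τ with ha
  set a' : ℂ := 1 / 2 * ∑ s, (m s : ℂ) * drho (x - z s) τ with ha'
  set κ : ℂ := ∑ s, ((exponent k s : ℕ) : ℂ) * rho (x - z s) τ with hκ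
  set κ' : ℂ := ∑ s, ((exponent k s : ℕ) : ℂ) * drho (x - z s) τ with hκ'
  have hh : cartanCoeff m z τ k x = a - κ := by
    rw [cartanCoeff, ha, hκ, Finset.mul_sum, ← Finset.sum_sub_distrib]
    refine Finset.sum_congr rfl fun s _ => ?_
    rw [exponent_apply]
    ring
  have hh' : ∑ s, drho (x - z s) τ * (((m s : ℂ) - 2 * (k s : ℕ)) / 2) = a' - κ' := by
    rw [ha', hκ', Finset.mul_sum, ← Finset.sum_sub_distrib]
    refine Finset.sum_congr rfl fun s _ => ?_
    rw [exponent_apply]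
    ring
  -- derivatives in `w`
  have hd1 : ∀ v ∉ lattice τ, deriv (betheVector m μ t z τ) v k =
      (betheForm₁ μ t z τ x v).coeff (exponent k) - κ * (betheForm μ t z τ v).coeff (exponent k) :=
    fun v hv => by
      have h1 := hasDerivAt_pi.mp
        (hdiff.differentiableAt (hopen.mem_nhds hv)).hasDerivAt k
      exact h1.unique (hasTwistedDeriv_betheForm hτ hx hv hB.t_sub_z hxt μ (exponent k))
  have hd2 : deriv (deriv (betheVector m μ t z τ)) w k =
      (betheForm₂ μ t z τ x w).coeff (exponent k) -
        2 * κ * (betheForm₁ μ t z τ x w).coeff (exponent k) +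
        κ ^ 2 * (betheForm μ t z τ w).coeff (exponent k) := by
    have h1 := hasDerivAt_pi.mp
      ((hdiff.deriv hopen).differentiableAt (hopen.mem_nhds hl)).hasDerivAt k
    have h2 := (hasTwistedDeriv_betheForm₁ hτ hx hl hB.t_sub_z hxt μ (exponent k)).sub
      ((hasTwistedDeriv_betheForm hτ hx hl hB.t_sub_z hxt μ (exponent k)).const_mul κ)
    have h3 := h1.unique (h2.congr_of_eventuallyEq (by
      filter_upwards [hopen.mem_nhds hl] with v hv
      exact hd1 v hv))
    rw [h3]
    ring
  -- the product of the off-diagonal entries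
  have hEF : ePlus m z τ 0 1 x lam (ePlus m z τ 1 0 x lam (betheVector m μ t z τ w)) k =
      (lowerForm z τ x w * ∑ s, MvPolynomial.C (sigma (x - z s) w τ) *
        raisePoly (m s) s (betheForm μ t z τ w)).coeff (exponent k) -
      2 * (a' - κ') * (betheForm μ t z τ w).coeff (exponent k) := by
    rw [betheVector, ePlus_one_zero_proj, ePlus_zero_one_proj, ← hwdef, proj]
    have e : ∑ s, MvPolynomial.C (sigma (x - z s) w τ) *
        raisePoly (m s) s (lowerForm z τ x w * betheForm μ t z τ w) =
        lowerForm z τ x w * (∑ s, MvPolynomial.C (sigma (x - z s) w τ) *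
          raisePoly (m s) s (betheForm μ t z τ w)) +
        ∑ s, MvPolynomial.C (drho w τ - drho (x - z s) τ) * (MvPolynomial.C (m s : ℂ) *
          betheForm μ t z τ w -
          MvPolynomial.C 2 * (MvPolynomial.X s * MvPolynomial.pderiv s (betheForm μ t z τ w))) := by
      rw [Finset.mul_sum, ← Finset.sum_add_distrib]
      refine Finset.sum_congr rfl fun s _ => ?_
      rw [lowerForm, raisePoly_linForm_mul, ← sigma_mul_sigma_neg hτ (hx s) hl, MvPolynomial.C_mul,
        lowerCoeff, map_ofNat]
      ring
    -- Zero weight removes the part ρ'(w) ∑ (m_s − 2k_s) of the commutator term.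
    have hz := mem_zeroWeight_iff.mp (hzero w) k
    rw [betheVector, proj] at hz
    rw [e, MvPolynomial.coeff_add, MvPolynomial.coeff_sum, ← hh', sub_eq_add_neg]
    congr 1
    simp only [MvPolynomial.coeff_C_mul, MvPolynomial.coeff_sub, coeff_X_mul_pderiv,
      exponent_apply]
    rw [Finset.mul_sum, Finset.sum_mul, ← Finset.sum_neg_distrib, ← sub_eq_zero,
      ← Finset.sum_sub_distrib, ← mul_zero (2 * drho w τ), ← hz, Finset.sum_mul, Finset.mul_sum]
    refine Finset.sum_congr rfl fun s _ => ?_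
    ring
  have hE := congrArg (MvPolynomial.coeff (exponent k))
    (betheForm_eigen hτ hx hl hxt hm hB (a' := a') ha)
  have hN : ∑ s, drho (x - z s) τ *
      (((exponent k s : ℕ) : ℂ) * (betheForm μ t z τ w).coeff (exponent k)) =
      κ' * (betheForm μ t z τ w).coeff (exponent k) := by
    rw [hκ', Finset.sum_mul]
    exact Finset.sum_congr rfl fun s _ => by ring
  simp only [MvPolynomial.coeff_add, MvPolynomial.coeff_sub, MvPolynomial.coeff_C_mul,
    MvPolynomial.coeff_sum, coeff_X_mul_pderiv] at hE
  rw [hN] at hE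
  have hU : betheLogDeriv m μ t z τ x =
      Real.pi * Complex.I * μ + ∑ i, rho (x - t i) τ - a := rfl
  have hv : betheVector m μ t z τ w k = (betheForm μ t z τ w).coeff (exponent k) := rfl
  rw [hd2, hd1 w hl, hEF, hh, hh', hU, hv]
  linear_combination -hE

lemma analyticAt_cartanCoeff {z : Fin n → ℂ} {τ x : ℂ} (hτ : 0 < τ.im)
    (hx : ∀ s, x - z s ∉ lattice τ) (k : (s : Fin n) → Fin (m s + 1)) :
    AnalyticAt ℂ (cartanCoeff m z τ k) x := by
  rw [Complex.analyticAt_iff_eventually_differentiableAt]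
  have h : ∀ᶠ y in 𝓝 x, ∀ s, y - z s ∉ lattice τ := by
    rw [eventually_all]
    exact fun s => (continuous_id.sub continuous_const).continuousAt.eventually
      (eventually_notMem_lattice hτ (hx s))
  filter_upwards [h] with y hy
  exact differentiableAt_cartanCoeff hτ hy k

/-- In `S2_apply` x enters only through ρ, ρ' and σ at the points x − z_s, so nothing is singular at
x = t_i. -/
lemma analyticAt_S2_betheVector {τ : ℂ} (hτ : 0 < τ.im) (hm : ∑ s, m s = 2 * M) {z : Fin n → ℂ}
    {x : ℂ} (hx : ∀ s, x - z s ∉ lattice τ) (t : Fin M → ℂ) (μ : ℂ) {lam : Fin 2 → ℂ}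
    (hl : lam 0 - lam 1 ∉ lattice τ) (k : (s : Fin n) → Fin (m s + 1)) :
    AnalyticAt ℂ (fun x => S2 m z τ x (fun lam => betheVector m μ t z τ (lam 0 - lam 1)) lam k)
      x := by
  have hev : ∀ᶠ y in 𝓝 x, ∀ s, y - z s ∉ lattice τ := by
    rw [eventually_all]
    exact fun s => (continuous_id.sub continuous_const).continuousAt.eventually
      (eventually_notMem_lattice hτ (hx s))
  have hσ : ∀ (s : Fin n) (v : ℂ), AnalyticAt ℂ (fun y => sigma (y - z s) v τ) x := fun s v => by
    rw [Complex.analyticAt_iff_eventually_differentiableAt]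
    filter_upwards [hev] with y hy
    exact (HasDerivAt.comp_sub_const y (z s)
      (hasDerivAt_sigma_left hτ v (hy s))).differentiableAt
  have hc := analyticAt_cartanCoeff hτ hx k
  have hc' := hc.deriv
  have hE : AnalyticAt ℂ (fun x => ePlus m z τ 0 1 x lam (ePlus m z τ 1 0 x lam
      (betheVector m μ t z τ (lam 0 - lam 1))) k) x := by
    simp only [ePlus_ePlus_apply]
    exact Finset.analyticAt_fun_sum _ fun s _ => Finset.analyticAt_fun_sum _ fun p _ =>
      (hσ s _).mul ((hσ p _).mul analyticAt_const)
  refine AnalyticAt.congr (f := fun x => -deriv (deriv (betheVector m μ t z τ)) (lam 0 - lam 1) k +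
        2 * cartanCoeff m z τ k x * deriv (betheVector m μ t z τ) (lam 0 - lam 1) k -
        (cartanCoeff m z τ k x ^ 2 + deriv (cartanCoeff m z τ k) x) *
          betheVector m μ t z τ (lam 0 - lam 1) k -
        ePlus m z τ 0 1 x lam (ePlus m z τ 1 0 x lam
          (betheVector m μ t z τ (lam 0 - lam 1))) k) (by fun_prop) ?_
  filter_upwards [hev] with y hy
  exact (S2_apply hτ (betheVector_mem_zeroWeight hm μ t z τ)
    (differentiableOn_betheVector hτ μ t z) hy hl k).symm

/-! ### The logarithmic derivative of a branch of u. -/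

lemma logDeriv_theta_sub {τ : ℂ} (hτ : 0 < τ.im) (x y : ℂ) :
    logDeriv (fun x => theta (x - y) τ) x = rho (x - y) τ := by
  rw [logDeriv_apply, (HasDerivAt.comp_sub_const x y (hasDerivAt_theta hτ (x - y))).deriv, rho_eq]

lemma differentiableAt_theta_sub {τ : ℂ} (hτ : 0 < τ.im) (x y : ℂ) :
    DifferentiableAt ℂ (fun x => theta (x - y) τ) x :=
  (HasDerivAt.comp_sub_const x y (hasDerivAt_theta hτ (x - y))).differentiableAt

/-- The logarithmic derivative of r² f^d = 1 determines that of r, whichever square root r is. -/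
lemma logDeriv_of_sq_eq_inv_pow {U : Set ℂ} (hU : IsOpen U) {r f : ℂ → ℂ} {d : ℕ}
    (hr : DifferentiableOn ℂ r U) (hf0 : ∀ x ∈ U, f x ≠ 0)
    (h : ∀ x ∈ U, r x ^ 2 = (f x ^ d)⁻¹) {x : ℂ} (hx : x ∈ U) (hf : DifferentiableAt ℂ f x) :
    r x ≠ 0 ∧ logDeriv r x = -(1 / 2) * (d * logDeriv f x) := by
  have hrd : DifferentiableAt ℂ r x := hr.differentiableAt (hU.mem_nhds hx)
  have hr0 : r x ≠ 0 := fun h0 => by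
    have h1 := h x hx
    rw [h0, zero_pow two_ne_zero, eq_comm, inv_eq_zero] at h1
    exact pow_ne_zero _ (hf0 x hx) h1
  refine ⟨hr0, ?_⟩
  have h1 : (fun y => r y ^ 2 * f y ^ d) =ᶠ[𝓝 x] fun _ => 1 := by
    filter_upwards [hU.mem_nhds hx] with y hy
    rw [h y hy, inv_mul_cancel₀ (pow_ne_zero _ (hf0 y hy))]
  have h2 : logDeriv (fun y => r y ^ 2 * f y ^ d) x = 0 := by
    rw [logDeriv_apply, h1.deriv_eq, deriv_const, zero_div]
  have h3 := logDeriv_mul (f := fun y => r y ^ 2) (g := fun y => f y ^ d) x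
    (pow_ne_zero _ hr0) (pow_ne_zero _ (hf0 x hx)) (hrd.pow 2) (hf.pow d)
  rw [h2, logDeriv_fun_pow hrd, logDeriv_fun_pow hf] at h3
  push_cast at h3
  linear_combination -h3 / 2

lemma logDeriv_exp_mul_const (a x : ℂ) : logDeriv (fun x => Complex.exp (a * x)) x = a := by
  have h : HasDerivAt (fun x => Complex.exp (a * x)) (Complex.exp (a * x) * a) x := by
    simpa using ((hasDerivAt_id x).const_mul a).cexp
  rw [logDeriv_apply, h.deriv, mul_div_cancel_left₀ _ (Complex.exp_ne_zero _)]

lemma logDeriv_branch {τ : ℂ} (hτ : 0 < τ.im) {z : Fin n → ℂ} {t : Fin M → ℂ} {μ : ℂ} {U : Set ℂ}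
    {u : ℂ → ℂ} (hu : IsBranchU m μ t z τ U u) {x : ℂ} (hx : x ∈ U) :
    logDeriv u x = betheLogDeriv m μ t z τ x := by
  obtain ⟨hUo, hU, r, hr, hur⟩ := hu
  have hθt : ∀ i, theta (x - t i) τ ≠ 0 := fun i h => (hU x hx).1 i ((theta_eq_zero_iff hτ).mp h)
  have hrx := fun s => logDeriv_of_sq_eq_inv_pow hUo (hr s).1
    (fun y hy h => (hU y hy).2 s ((theta_eq_zero_iff hτ).mp h)) (hr s).2 hx
    (differentiableAt_theta_sub hτ x (z s))
  have hrd : ∀ s, DifferentiableAt ℂ (r s) x := fun s =>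
    (hr s).1.differentiableAt (hUo.mem_nhds hx)
  set e : ℂ → ℂ := fun x => Complex.exp (Real.pi * Complex.I * μ * x) with he
  set T : ℂ → ℂ := fun x => ∏ i, theta (x - t i) τ with hT
  set R : ℂ → ℂ := fun x => ∏ s, r s x with hR
  have hev : u =ᶠ[𝓝 x] fun x => e x * T x * R x := by
    filter_upwards [hUo.mem_nhds hx] with y hy
    exact hur y hy
  have he0 : e x ≠ 0 := Complex.exp_ne_zero _
  have hT0 : T x ≠ 0 := Finset.prod_ne_zero_iff.mpr fun i _ => hθt i
  have hR0 : R x ≠ 0 := Finset.prod_ne_zero_iff.mpr fun s _ => (hrx s).1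
  have de : DifferentiableAt ℂ e x := by fun_prop
  have dT : DifferentiableAt ℂ T x :=
    DifferentiableAt.fun_finsetProd fun i _ => differentiableAt_theta_sub hτ x (t i)
  have dR : DifferentiableAt ℂ R x := DifferentiableAt.fun_finsetProd fun s _ => hrd s
  have le : logDeriv e x = Real.pi * Complex.I * μ := logDeriv_exp_mul_const _ x
  have lT : logDeriv T x = ∑ i, rho (x - t i) τ := by
    rw [hT, logDeriv_prod (f := fun i x => theta (x - t i) τ) (fun i _ => hθt i)
      (fun i _ => differentiableAt_theta_sub hτ x (t i))]
    exact Finset.sum_congr rfl fun i _ => logDeriv_theta_sub hτ x (t i)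
  have lR : logDeriv R x = -(1 / 2) * ∑ s, (m s : ℂ) * rho (x - z s) τ := by
    rw [hR, logDeriv_prod (f := r) (fun s _ => (hrx s).1) (fun s _ => hrd s), Finset.mul_sum]
    exact Finset.sum_congr rfl fun s _ => by rw [(hrx s).2, logDeriv_theta_sub hτ x (z s)]
  have h1 : logDeriv u x = logDeriv (fun x => e x * T x * R x) x := by
    rw [logDeriv_apply, logDeriv_apply, hev.deriv_eq, hev.eq_of_nhds]
  have h2 : logDeriv (fun x => e x * T x * R x) x = logDeriv e x + logDeriv T x + logDeriv R x := by
    rw [logDeriv_mul (f := fun x => e x * T x) (g := R) x (mul_ne_zero he0 hT0) hR0 (de.mul dT) dR,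
      logDeriv_mul (f := e) (g := T) x he0 hT0 de dT]
  rw [h1, h2, le, lT, lR, betheLogDeriv]
  ring

end Eigenvalue

/-! ### The main theorem -/

section Main

variable {n M : ℕ} {m : Fin n → ℕ}

lemma isOpen_forall_sub_notMem_lattice {τ : ℂ} (hτ : 0 < τ.im) (z : Fin n → ℂ) :
    IsOpen {x | ∀ s, x - z s ∉ lattice τ} := by
  simp only [Set.ofPred_forall]
  exact isOpen_iInter_of_finite fun s =>
    (isClosed_lattice hτ).isOpen_compl.preimage (continuous_id.sub continuous_const)

lemma dense_forall_sub_notMem_lattice (τ : ℂ) (t : Fin M → ℂ) :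
    Dense {x | ∀ i, x - t i ∉ lattice τ} := by
  have hc : (⋃ i, (fun l => l + t i) '' lattice τ).Countable :=
    countable_iUnion fun i => (countable_lattice τ).image _
  refine (hc.dense_compl ℂ).mono fun x (hx : ¬ _) i hi => hx ?_
  exact mem_iUnion.mpr ⟨i, _, hi, sub_add_cancel _ _⟩

/-- The ratio at a base point with a nonzero coordinate serves as eigenvalue. Away from the t_i it
is −U' − U²; both sides are continuous in x and such x are dense, so the equation persists at the
t_i. -/
lemma S2_betheVector_eq_smul {τ : ℂ} (hτ : 0 < τ.im) (hm : ∑ s, m s = 2 * M) {z : Fin n → ℂ}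
    {t : Fin M → ℂ} {μ : ℂ} (hB : IsBetheSolution m μ t z τ) {lam₀ : Fin 2 → ℂ}
    (hl₀ : lam₀ 0 - lam₀ 1 ∉ lattice τ) {k₀ : (s : Fin n) → Fin (m s + 1)}
    (hk₀ : betheVector m μ t z τ (lam₀ 0 - lam₀ 1) k₀ ≠ 0) {x : ℂ}
    (hx : ∀ s, x - z s ∉ lattice τ) {lam : Fin 2 → ℂ} (hl : lam 0 - lam 1 ∉ lattice τ) :
    S2 m z τ x (fun lam => betheVector m μ t z τ (lam 0 - lam 1)) lam =
      (S2 m z τ x (fun lam => betheVector m μ t z τ (lam 0 - lam 1)) lam₀ k₀ /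
        betheVector m μ t z τ (lam₀ 0 - lam₀ 1) k₀) • betheVector m μ t z τ (lam 0 - lam 1) := by
  funext k
  rw [Pi.smul_apply, smul_eq_mul, ← sub_eq_zero]
  have hF : ContinuousAt (fun x => S2 m z τ x (fun lam => betheVector m μ t z τ (lam 0 - lam 1))
      lam k - S2 m z τ x (fun lam => betheVector m μ t z τ (lam 0 - lam 1)) lam₀ k₀ /
        betheVector m μ t z τ (lam₀ 0 - lam₀ 1) k₀ * betheVector m μ t z τ (lam 0 - lam 1) k) x :=
    (analyticAt_S2_betheVector hτ hm hx t μ hl k).continuousAt.sub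
      (((analyticAt_S2_betheVector hτ hm hx t μ hl₀ k₀).continuousAt.div_const _).mul
        continuousAt_const)
  by_contra h0
  have hfreq := mem_closure_iff_frequently.mp (dense_forall_sub_notMem_lattice τ t x)
  obtain ⟨y, hyt, hy0, hyz⟩ := (hfreq.and_eventually ((hF.eventually_ne h0).and
    ((isOpen_forall_sub_notMem_lattice hτ z).mem_nhds hx))).exists
  apply hy0
  rw [S2_betheVector_of_notMem hτ hm hyz hyt hB hl, S2_betheVector_of_notMem hτ hm hyz hyt hB hl₀,
    mul_div_cancel_right₀ _ hk₀, sub_self]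

lemma fundOp_eq_firstOrderOp {B a f : ℂ → ℂ} {U : Set ℂ} (hU : IsOpen U)
    (ha : DifferentiableOn ℂ a U) (hB : ∀ x ∈ U, B x = -deriv a x - a x ^ 2)
    (hf : DifferentiableOn ℂ f U) {x : ℂ} (hx : x ∈ U) :
    fundOp B f x = firstOrderOp a (firstOrderOp (fun y => -a y) f) x := by
  have hfx := (hf.differentiableAt (hU.mem_nhds hx)).hasDerivAt
  have hfx' := ((hf.deriv hU).differentiableAt (hU.mem_nhds hx)).hasDerivAt
  have hax := (ha.differentiableAt (hU.mem_nhds hx)).hasDerivAt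
  have h : deriv (firstOrderOp (fun y => -a y) f) x =
      deriv (deriv f) x + (-deriv a x * f x + -a x * deriv f x) :=
    (hfx'.add (hax.neg.mul hfx)).deriv
  rw [fundOp, firstOrderOp, h, firstOrderOp, hB x hx]
  ring

end Main

end EllipticBethe

end

theorem mainTheorem8 {n M : ℕ} (m : Fin n → ℕ) (hm : ∑ s, m s = 2 * M)
    (μ τ : ℂ) (hτ : 0 < τ.im) (t : Fin M → ℂ) (z : Fin n → ℂ)
    (hz : ∀ s p, s ≠ p → z s - z p ∉ EllipticBethe.lattice τ)
    (hBAE : EllipticBethe.IsBetheSolution m μ t z τ) :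
    EllipticBethe.IsFun m (EllipticBethe.betheFunction m μ t z τ) ∧
    (∃ lam : Fin 2 → ℂ, lam 0 - lam 1 ∉ EllipticBethe.lattice τ ∧
      EllipticBethe.betheFunction m μ t z τ lam ≠ 0) ∧
    (∃ B : ℂ → ℂ,
      EllipticBethe.IsS2Eigenvalue m z τ (EllipticBethe.betheFunction m μ t z τ) B) ∧
    ∀ B : ℂ → ℂ,
      EllipticBethe.IsS2Eigenvalue m z τ (EllipticBethe.betheFunction m μ t z τ) B →
      AnalyticOnNhd ℂ B {x | ∀ s, x - z s ∉ EllipticBethe.lattice τ} ∧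
      ∀ (U : Set ℂ) (u : ℂ → ℂ), EllipticBethe.IsBranchU m μ t z τ U u →
        (∀ x ∈ U, B x = - deriv (logDeriv u) x - (logDeriv u x) ^ 2) ∧
        ∀ f : ℂ → ℂ, DifferentiableOn ℂ f U → ∀ x ∈ U,
          EllipticBethe.fundOp B f x =
            EllipticBethe.firstOrderOp (logDeriv u)
              (EllipticBethe.firstOrderOp (fun y => - logDeriv u y) f) x := by
  open EllipticBethe in
  obtain ⟨w, hw, k, hk⟩ := exists_betheVector_ne_zero (m := m) hτ hm μ hBAE.t_sub_z
  have hlam : (![w, 0] : Fin 2 → ℂ) 0 - (![w, 0] : Fin 2 → ℂ) 1 = w := by simp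
  have hl : (![w, 0] : Fin 2 → ℂ) 0 - (![w, 0] : Fin 2 → ℂ) 1 ∉ lattice τ := by rwa [hlam]
  have hk' : betheVector m μ t z τ ((![w, 0] : Fin 2 → ℂ) 0 - (![w, 0] : Fin 2 → ℂ) 1) k ≠ 0 := by
    rwa [hlam]
  refine ⟨isFun_betheFunction hτ hm μ t z, ⟨![w, 0], hl, fun h => hk' ?_⟩, ?_, fun B hB => ?_⟩
  · rw [betheFunction_eq] at h
    exact congrFun h k
  · rw [betheFunction_eq]
    exact ⟨_, fun x hx lam hlam => S2_betheVector_eq_smul hτ hm hBAE hl hk' hx hlam⟩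
  · rw [betheFunction_eq] at hB
    -- One nonzero coordinate of Ψ determines B, so B inherits its analyticity and its value from
    -- S_2(x)Ψ.
    have hBx : ∀ x, (∀ s, x - z s ∉ lattice τ) →
        S2 m z τ x (fun lam => betheVector m μ t z τ (lam 0 - lam 1)) ![w, 0] k /
          betheVector m μ t z τ ((![w, 0] : Fin 2 → ℂ) 0 - (![w, 0] : Fin 2 → ℂ) 1) k = B x :=
      fun x hx => by
        rw [hB x hx _ hl, Pi.smul_apply, smul_eq_mul, mul_div_cancel_right₀ _ hk']
    refine ⟨fun x hx => ?_, fun U u hu => ?_⟩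
    · refine ((analyticAt_S2_betheVector hτ hm hx t μ hl k).div_const
        (c := betheVector m μ t z τ ((![w, 0] : Fin 2 → ℂ) 0 - (![w, 0] : Fin 2 → ℂ) 1) k)).congr ?_
      filter_upwards [(isOpen_forall_sub_notMem_lattice hτ z).mem_nhds hx] with y hy
      exact hBx y hy
    · have hlog : ∀ x ∈ U, logDeriv u x = betheLogDeriv m μ t z τ x := fun x hx =>
        logDeriv_branch hτ hu hx
      have hev : ∀ x ∈ U, logDeriv u =ᶠ[nhds x] betheLogDeriv m μ t z τ := fun x hx => by
        filter_upwards [hu.1.mem_nhds hx] with y hy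
        exact hlog y hy
      have hBu : ∀ x ∈ U, B x = - deriv (logDeriv u) x - (logDeriv u x) ^ 2 := fun x hx => by
        rw [← hBx x (hu.2.1 x hx).2,
          S2_betheVector_of_notMem hτ hm (hu.2.1 x hx).2 (hu.2.1 x hx).1 hBAE hl,
          mul_div_cancel_right₀ _ hk', (hev x hx).deriv_eq, hlog x hx]
      refine ⟨hBu, fun f hf x hx => fundOp_eq_firstOrderOp hu.1 (fun y hy => ?_) hBu hf hx⟩
      exact ((hasDerivAt_betheLogDeriv hτ (hu.2.1 y hy).2 (hu.2.1 y hy).1 μ).differentiableAt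
        |>.congr_of_eventuallyEq (hev y hy)).differentiableWithinAt
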